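/- **Setting.** For $n\in\mathbb N$ let $\mathcal H_n$ be the Haar distribution on $n$-qubit pure states (the uniform probability measure on the unit sphere of $\mathbb C^{2^n}$), and let $\mathsf{TD}(\rho,\sigma)=\tfrac12\|\rho-\sigma\|_1$ be the trace distance. Let $n:\mathbb N\to\mathbb N$ (number of qubits of the common Haar state) and $\ell:\mathbb N\to\mathbb N$ (number of copies). A family of maps $G=\{G_k\}$, where for each $\lambda\in\mathbb N$ and $k\in\{0,1\}^\lambda$ the map $G_k$ acts on operators of $n(\lambda)$ qubits, is a *multi-key statistically secure $(\lambda,n,\ell)$-PRS generator in the common Haar state (CHS) model* if 1. $G$ is quantum polynomial time: some polynomial-time Turing machine, on input $1^\lambda$, prints a quantum circuit (over a fixed finite universal gate set, with ancillas initialised to $|0\rangle$) which on input $|k\rangle\langle k|\otimes\rho$ outputs $G_k(\rho)$ in its state register; 2. every $G_k$ is a quantum channel that maps each pure state $|\vartheta\rangle\langle\vartheta|$ to a pure state $|\vartheta_k\rangle\langle\vartheta_k|$; 3. for all polynomially bounded $t,p:\mathbb N\to\mathbb N$ and every non-uniform, unbounded adversary $A=\{A_\lambda\}$ (for each $\lambda$,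 an arbitrary two-outcome measurement) there is a negligible function $\mathsf{negl}$ with, for all $\lambda$ and with $n,\ell,t,p$ evaluated at $\lambda$, $$\Bigl|\Pr_{k_1,\dots,k_p\leftarrow\{0,1\}^\lambda,\ \vartheta\leftarrow\mathcal H_{n}}\Bigl[A_\lambda\Bigl(\bigotimes_{i=1}^{p}G_{k_i}(|\vartheta\rangle\langle\vartheta|)^{\otimes\ell}\otimes|\vartheta\rangle\langle\vartheta|^{\otimes t}\Bigr)=1\Bigr]-\Pr_{\varphi_1,\dots,\varphi_p,\vartheta\leftarrow\mathcal H_{n}}\Bigl[A_\lambda\Bigl(\bigotimes_{i=1}^{p}|\varphi_i\rangle\langle\varphi_i|^{\otimes\ell}\otimes|\vartheta\rangle\langle\vartheta|^{\otimes t}\Bigr)=1\Bigr]\Bigr|\le\mathsf{negl}(\lambda).$$ **Construction.** For $\lambda\le n$ and $k\in\{0,1\}^\lambda$ let $G_k(|\vartheta\rangle)=(Z^k\otimes I_{n-\lambda})|\vartheta\rangle$, where $Z^k=Z^{k_1}\otimes\cdots\otimes Z^{k_\lambda}$; that is, $G_k(\rho)=(Z^k\otimes I_{n-\lambda})\,\rho\,(Z^k\otimes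 I_{n-\lambda})^\dagger$. **Theorem.** (a) Let $n(\lambda)\ge\lambda$ for all $\lambda$, let $\varepsilon>0$ be a constant, and let $\ell(\lambda)=O\bigl(\lambda/\log(\lambda)^{1+\varepsilon}\bigr)$. Then $G$ is a multi-key statistically secure $(\lambda,n,\ell)$-PRS generator in the CHS model; in particular such a generator exists. (b) There is an absolute constant $c$ such that for all natural numbers $\lambda,n,\ell,t$ with $\lambda\le n$, $$\mathsf{TD}\Bigl(\mathop{\mathbb E}_{k\leftarrow\{0,1\}^\lambda,\ \vartheta\leftarrow\mathcal H_n}\bigl[G_k(|\vartheta\rangle\langle\vartheta|)^{\otimes\ell}\otimes|\vartheta\rangle\langle\vartheta|^{\otimes t}\bigr],\ \mathop{\mathbb E}_{\varphi,\vartheta\leftarrow\mathcal H_n}\bigl[|\varphi\rangle\langle\varphi|^{\otimes\ell}\otimes|\vartheta\rangle\langle\vartheta|^{\otimes t}\bigr]\Bigr)\le c\,\frac{(\ell+t)^{2\ell}}{2^\lambda}.$$ (c) There is an absolute constant $c$ such that for all natural numbers $\lambda,n,\ell,t,p$ with $\lambda\le n$, $$\mathsf{TD}\Bigl(\mathop{\mathbb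 E}_{k_1,\dots,k_p\leftarrow\{0,1\}^\lambda,\ \vartheta\leftarrow\mathcal H_n}\Bigl[\bigotimes_{i=1}^pG_{k_i}(|\vartheta\rangle\langle\vartheta|)^{\otimes\ell}\otimes|\vartheta\rangle\langle\vartheta|^{\otimes t}\Bigr],\ \mathop{\mathbb E}_{\varphi_1,\dots,\varphi_p,\vartheta\leftarrow\mathcal H_n}\Bigl[\bigotimes_{i=1}^p|\varphi_i\rangle\langle\varphi_i|^{\otimes\ell}\otimes|\vartheta\rangle\langle\vartheta|^{\otimes t}\Bigr]\Bigr)\le c\,\frac{p\,(p\ell+t)^{2\ell}}{2^\lambda}.$$ Here $0^0=1$, and the $\varphi$'s, $\vartheta$ and the keys are independent. -/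

import Mathlib

noncomputable section

namespace CHS

open scoped BigOperators Matrix Kronecker ComplexOrder

/-! ### Qubits, operators and tensor powers -/

/-- Computational basis labels of `n` qubits, i.e. bit strings of length `n`. -/
abbrev Bits (n : ℕ) : Type := Fin n → Bool

/-- Operators on the Hilbert space with orthonormal basis `ι`. -/
abbrev Op (ι : Type) : Type := Matrix ι ι ℂ

/-- The tensor product `⨂ i, A i` of a finite family of operators. -/
def tensorPi {κ ι : Type} [Fintype κ] (A : κ → Op ι) : Op (κ → ι) :=
  Matrix.of fun x y => ∏ i, A i (x i) (y i)

/-- The tensor power `A ^ ⊗ m`. -/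
def tensorPow {ι : Type} (A : Op ι) (m : ℕ) : Op (Fin m → ι) :=
  tensorPi fun _ : Fin m => A

/-- The trace norm `‖X‖₁ = Tr √(Xᴴ X)`: the sum of the square roots of the eigenvalues of
`Xᴴ X`, with multiplicity. -/
def traceNorm {ι : Type} [Fintype ι] [DecidableEq ι] (X : Op ι) : ℝ :=
  ∑ i, √((Matrix.isHermitian_conjTranspose_mul_self X).eigenvalues i)

/-- The trace distance `‖ρ - σ‖₁ / 2`. -/
def traceDist {ι : Type} [Fintype ι] [DecidableEq ι] (ρ σ : Op ι) : ℝ :=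
  traceNorm (ρ - σ) / 2

/-! ### Haar random states -/

/-- Unit vectors of the `n`-qubit Hilbert space. -/
abbrev PureState (n : ℕ) : Type := Metric.sphere (0 : EuclideanSpace ℂ (Bits n)) 1

/-- The rank one projection `|ψ⟩⟨ψ|`. -/
def PureState.density {n : ℕ} (ψ : PureState n) : Op (Bits n) :=
  Matrix.of fun x y => ψ.1 x * star (ψ.1 y)

/-- The Haar distribution on `n`-qubit pure states: the uniform (rotation invariant)
probability measure on the unit sphere. -/
def haarState (n : ℕ) : MeasureTheory.Measure (PureState n) :=
  ((MeasureTheory.volume : MeasureTheory.Measure (EuclideanSpace ℂ (Bits n))).toSphere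
      Set.univ)⁻¹ •
    (MeasureTheory.volume : MeasureTheory.Measure (EuclideanSpace ℂ (Bits n))).toSphere

instance (n : ℕ) : MeasureTheory.IsProbabilityMeasure (haarState n) := by
  constructor
  have h0 : (MeasureTheory.volume :
      MeasureTheory.Measure (EuclideanSpace ℂ (Bits n))).toSphere Set.univ ≠ 0 := by
    rw [Ne, MeasureTheory.Measure.measure_univ_eq_zero]
    exact MeasureTheory.Measure.toSphere_ne_zero _
  rw [haarState, MeasureTheory.Measure.smul_apply, smul_eq_mul]
  exact ENNReal.inv_mul_cancel h0 (MeasureTheory.measure_ne_top _ _)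

/-! ### Quantum circuits and efficient generators -/

/-- The three registers of a generation circuit: the key, the common Haar state (which is also
the output register), and ancillas. -/
inductive Reg
  | key | st | anc
  deriving DecidableEq

/-- The name of a wire: a register and a position in it. -/
structure Loc where
  reg : Reg
  idx : ℕ

/-- Gates over the universal gate set Hadamard, T, controlled NOT, controlled Z. -/
inductive Gate
  | had (w : Loc)
  | tee (w : Loc)
  | cnot (c w : Loc)
  | cz (c w : Loc)

/-- A circuit is the list of its gates; the head of the list is applied first. -/
abbrev Circuit : Type := List Gate

/-- The alphabet in which circuits are written down. -/
inductive Sym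
  | had | tee | cnot | cz | key | st | anc | tick | sep
  deriving DecidableEq

def Reg.sym : Reg → Sym
  | .key => .key
  | .st => .st
  | .anc => .anc

/-- A wire name is written as its register, its position in unary, and a separator. -/
def Loc.encode (w : Loc) : List Sym :=
  w.reg.sym :: (List.replicate w.idx Sym.tick ++ [Sym.sep])

def Gate.encode : Gate → List Sym
  | .had w => Sym.had :: w.encode
  | .tee w => Sym.tee :: w.encode
  | .cnot c w => Sym.cnot :: (c.encode ++ w.encode)
  | .cz c w => Sym.cz :: (c.encode ++ w.encode)

/-- The description of a circuit. -/
def encodeCircuit (C : Circuit) : List Sym := C.flatMap Gate.encode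

theorem Loc.encode_append_inj {v w : Loc} {l l' : List Sym}
    (h : v.encode ++ l = w.encode ++ l') : v = w ∧ l = l' := by
  obtain ⟨r, i⟩ := v
  obtain ⟨s, j⟩ := w
  simp only [Loc.encode, List.cons_append, List.append_assoc, List.cons.injEq,
    List.nil_append] at h
  obtain ⟨hr, h⟩ := h
  have hrs : r = s := by cases r <;> cases s <;> simp_all [Reg.sym]
  subst hrs
  have key : ∀ (i j : ℕ), List.replicate i Sym.tick ++ (Sym.sep :: l) =
      List.replicate j Sym.tick ++ (Sym.sep :: l') → i = j ∧ l = l' := by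
    intro i
    induction i with
    | zero =>
      intro j hj
      cases j with
      | zero => simpa using hj
      | succ j => simp [List.replicate_succ] at hj
    | succ i ih =>
      intro j hj
      cases j with
      | zero => simp [List.replicate_succ] at hj
      | succ j =>
        simp only [List.replicate_succ, List.cons_append, List.cons.injEq, true_and] at hj
        obtain ⟨h1, h2⟩ := ih j hj
        exact ⟨by rw [h1], h2⟩
  obtain ⟨h1, h2⟩ := key i j h
  exact ⟨by rw [h1], h2⟩

/-- Circuits can be recovered from their descriptions. -/
theorem encodeCircuit_injective : Function.Injective encodeCircuit := by
  intro C
  induction C with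
  | nil =>
    intro D h
    cases D with
    | nil => rfl
    | cons g D => cases g <;> simp [encodeCircuit, Gate.encode] at h
  | cons f C ih =>
    intro D h
    cases D with
    | nil => cases f <;> simp [encodeCircuit, Gate.encode] at h
    | cons g D =>
      have hC : ∀ (g : Gate) (C : Circuit),
          encodeCircuit (g :: C) = g.encode ++ encodeCircuit C := fun g C => by
        simp [encodeCircuit]
      rw [hC, hC] at h
      cases f <;> cases g <;>
        simp only [Gate.encode, List.cons_append, List.append_assoc, List.cons.injEq,
          reduceCtorEq, false_and, true_and] at h
      all_goals
        obtain ⟨h1, h⟩ := Loc.encode_append_inj h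
        first
          | (rw [h1, ih h])
          | (obtain ⟨h2, h⟩ := Loc.encode_append_inj h
             rw [h1, h2, ih h])

/-- The wires of a circuit with `lam` key qubits, `n` state qubits and `a` ancillas. -/
abbrev Wire (lam n a : ℕ) : Type := Fin lam ⊕ Fin n ⊕ Fin a

/-- The wire with a given name, if there is one. -/
def Loc.wire (lam n a : ℕ) (w : Loc) : Option (Wire lam n a) :=
  match w.reg with
  | .key => if h : w.idx < lam then some (Sum.inl ⟨w.idx, h⟩) else none
  | .st => if h : w.idx < n then some (Sum.inr (Sum.inl ⟨w.idx, h⟩)) else none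
  | .anc => if h : w.idx < a then some (Sum.inr (Sum.inr ⟨w.idx, h⟩)) else none

section Gates

variable {W : Type} [Fintype W] [DecidableEq W]

/-- The one-qubit operator `u` on wire `w`, and the identity on all other wires. -/
def onWire (u : Op Bool) (w : W) : Op (W → Bool) :=
  Matrix.of fun x y => if ∀ v, v ≠ w → x v = y v then u (x w) (y w) else 0

def hadamard : Op Bool :=
  Matrix.of fun a b => (if a && b then -1 else 1) / (√2 : ℝ)

def tGate : Op Bool :=
  Matrix.diagonal fun b => if b then Complex.exp (Real.pi * Complex.I / 4) else 1

/-- Controlled NOT: `|y⟩ ↦ |y with bit w replaced by y w xor y c⟩`. -/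
def cnotOp (c w : W) : Op (W → Bool) :=
  Matrix.of fun x y => if x = Function.update y w (xor (y w) (y c)) then 1 else 0

/-- Controlled Z. -/
def czOp (c w : W) : Op (W → Bool) :=
  Matrix.diagonal fun x => if x c && x w then -1 else 1

end Gates

/-- The unitary of a gate. A gate that names a wire which does not exist, and a two-qubit gate
whose two wires coincide, are skipped. -/
def Gate.op (lam n a : ℕ) : Gate → Op (Wire lam n a → Bool)
  | .had w => match w.wire lam n a with
    | some v => onWire hadamard v
    | none => 1
  | .tee w => match w.wire lam n a with
    | some v => onWire tGate v
    | none => 1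
  | .cnot c w => match c.wire lam n a, w.wire lam n a with
    | some u, some v => if u = v then 1 else cnotOp u v
    | _, _ => 1
  | .cz c w => match c.wire lam n a, w.wire lam n a with
    | some u, some v => if u = v then 1 else czOp u v
    | _, _ => 1

/-- The unitary of a circuit. -/
def Circuit.op (lam n a : ℕ) (C : Circuit) : Op (Wire lam n a → Bool) :=
  C.foldl (fun U g => g.op lam n a * U) 1

def Gate.locs : Gate → List Loc
  | .had w => [w]
  | .tee w => [w]
  | .cnot c w => [c, w]
  | .cz c w => [c, w]

/-- The number of ancillas of a circuit: one more than the largest ancilla position it names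
(zero if it names none). -/
def Circuit.ancillas (C : Circuit) : ℕ :=
  (C.flatMap Gate.locs).foldr
    (fun w m => match w.reg with
      | .anc => max (w.idx + 1) m
      | _ => m) 0

/-- The basis label of all wires assembled from those of the three registers. -/
def joinBits {lam n a : ℕ} (k : Bits lam) (x : Bits n) (z : Bits a) : Wire lam n a → Bool :=
  Sum.elim k (Sum.elim x z)

/-- The operator `|k⟩⟨k| ⊗ ρ ⊗ |0⟩⟨0|` on all wires. -/
def inputOp {lam n : ℕ} (a : ℕ) (k : Bits lam) (ρ : Op (Bits n)) :
    Op (Wire lam n a → Bool) :=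
  Matrix.of fun x y =>
    if ((fun i => x (Sum.inl i)) = k ∧ ∀ i, x (Sum.inr (Sum.inr i)) = false) ∧
        ((fun i => y (Sum.inl i)) = k ∧ ∀ i, y (Sum.inr (Sum.inr i)) = false) then
      ρ (fun i => x (Sum.inr (Sum.inl i))) (fun i => y (Sum.inr (Sum.inl i)))
    else 0

/-- The partial trace over the key register and the ancillas. -/
def traceOut {lam n a : ℕ} (X : Op (Wire lam n a → Bool)) : Op (Bits n) :=
  Matrix.of fun x y => ∑ k : Bits lam, ∑ z : Bits a, X (joinBits k x z) (joinBits k y z)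

/-- Run a circuit with `a` ancillas on key `k` and input `ρ`. -/
def runWith {lam n : ℕ} (a : ℕ) (C : Circuit) (k : Bits lam) (ρ : Op (Bits n)) : Op (Bits n) :=
  traceOut (C.op lam n a * inputOp a k ρ * (C.op lam n a)ᴴ)

/-- Run a circuit on key `k` and input `ρ`. -/
def Circuit.run {lam n : ℕ} (C : Circuit) (k : Bits lam) (ρ : Op (Bits n)) : Op (Bits n) :=
  runWith C.ancillas C k ρ

/-- A generator: for every security parameter `lam` and every key in `{0,1}^lam`, a map on
operators of `n lam` qubits. -/
abbrev Generator (n : ℕ → ℕ) : Type :=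
  ∀ lam : ℕ, Bits lam → Op (Bits (n lam)) → Op (Bits (n lam))

/-- Quantum polynomial time: some classical Turing machine prints, on input `1^lam` and in time
polynomial in `lam`, a quantum circuit that implements the generator. -/
def IsQPT {n : ℕ → ℕ} (G : Generator n) : Prop :=
  ∃ C : ℕ → Circuit,
    Nonempty (Turing.TM2ComputableInPolyTime Computability.unaryEncodeNat encodeCircuit C) ∧
    ∀ lam k ρ, G lam k ρ = (C lam).run k ρ

/-- Quantum channels (completely positive trace preserving maps), in Kraus form. -/
def IsChannel {ι : Type} [Fintype ι] [DecidableEq ι] (Φ : Op ι → Op ι) : Prop :=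
  ∃ (r : ℕ) (K : Fin r → Op ι), ∑ i, (K i)ᴴ * K i = 1 ∧ ∀ ρ, Φ ρ = ∑ i, K i * ρ * (K i)ᴴ

/-! ### Pseudorandom state generators in the common Haar state model -/

section Security

variable {lam n : ℕ}

/-- `E_{k, ϑ} [ G_k(|ϑ⟩⟨ϑ|)^{⊗ ℓ} ⊗ |ϑ⟩⟨ϑ|^{⊗ t} ]`. -/
def realState (G : Bits lam → Op (Bits n) → Op (Bits n)) (ℓ t : ℕ) :
    Op ((Fin ℓ → Bits n) × (Fin t → Bits n)) :=
  Matrix.of fun x y => 𝔼 k : Bits lam, ∫ ϑ : PureState n,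
    (tensorPow (G k ϑ.density) ℓ ⊗ₖ tensorPow ϑ.density t) x y ∂haarState n

/-- `E_{φ, ϑ} [ |φ⟩⟨φ|^{⊗ ℓ} ⊗ |ϑ⟩⟨ϑ|^{⊗ t} ]`. -/
def idealState (n ℓ t : ℕ) : Op ((Fin ℓ → Bits n) × (Fin t → Bits n)) :=
  Matrix.of fun x y => ∫ ω : PureState n × PureState n,
    (tensorPow ω.1.density ℓ ⊗ₖ tensorPow ω.2.density t) x y
      ∂((haarState n).prod (haarState n))

/-- `E_{k_1, …, k_p, ϑ} [ (⨂ i, G_{k_i}(|ϑ⟩⟨ϑ|)^{⊗ ℓ}) ⊗ |ϑ⟩⟨ϑ|^{⊗ t} ]`. -/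
def realStateMulti (G : Bits lam → Op (Bits n) → Op (Bits n)) (ℓ t p : ℕ) :
    Op ((Fin p → Fin ℓ → Bits n) × (Fin t → Bits n)) :=
  Matrix.of fun x y => 𝔼 k : Fin p → Bits lam, ∫ ϑ : PureState n,
    (tensorPi (fun i => tensorPow (G (k i) ϑ.density) ℓ) ⊗ₖ tensorPow ϑ.density t) x y
      ∂haarState n

/-- `E_{φ_1, …, φ_p, ϑ} [ (⨂ i, |φ_i⟩⟨φ_i|^{⊗ ℓ}) ⊗ |ϑ⟩⟨ϑ|^{⊗ t} ]`. -/
def idealStateMulti (n ℓ t p : ℕ) : Op ((Fin p → Fin ℓ → Bits n) × (Fin t → Bits n)) :=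
  Matrix.of fun x y => ∫ ω : (Fin p → PureState n) × PureState n,
    (tensorPi (fun i => tensorPow (ω.1 i).density ℓ) ⊗ₖ tensorPow ω.2.density t) x y
      ∂((MeasureTheory.Measure.pi fun _ : Fin p => haarState n).prod (haarState n))

end Security

/-- The `accept` element `M` of a measurement `{M, 1 - M}`: an arbitrary (unbounded)
distinguisher with one bit of output. -/
structure Test (ι : Type) [Fintype ι] [DecidableEq ι] where
  M : Op ι
  pos : M.PosSemidef
  le_one : (1 - M).PosSemidef

/-- The probability that the test outputs `1` on the state `ρ`. -/
def Test.prob {ι : Type} [Fintype ι] [DecidableEq ι] (A : Test ι) (ρ : Op ι) : ℝ :=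
  (A.M * ρ).trace.re

def PolyBounded (f : ℕ → ℕ) : Prop := ∃ q : Polynomial ℕ, ∀ m, f m ≤ q.eval m

def Negligible (f : ℕ → ℝ) : Prop :=
  Asymptotics.SuperpolynomialDecay Filter.atTop (fun m : ℕ => (m : ℝ)) f

/-- Multi-key statistically secure `(lam, n, ℓ)`-pseudorandom state generators in the common
Haar state model. -/
structure IsMultiKeyPRSG (n ℓ : ℕ → ℕ) (G : Generator n) : Prop where
  qpt : IsQPT G
  channel : ∀ lam k, IsChannel (G lam k)
  stateGeneration : ∀ lam k (ϑ : PureState (n lam)), ∃ ϑ' : PureState (n lam),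
    G lam k ϑ.density = ϑ'.density
  pseudorandomness : ∀ t p : ℕ → ℕ, PolyBounded t → PolyBounded p →
    ∀ A : ∀ lam : ℕ,
      Test ((Fin (p lam) → Fin (ℓ lam) → Bits (n lam)) × (Fin (t lam) → Bits (n lam))),
    ∃ negl : ℕ → ℝ, Negligible negl ∧ ∀ lam,
      |(A lam).prob (realStateMulti (G lam) (ℓ lam) (t lam) (p lam)) -
        (A lam).prob (idealStateMulti (n lam) (ℓ lam) (t lam) (p lam))| ≤ negl lam

/-! ### The construction -/

/-- The Pauli operator `Z = diag(1, -1)`. -/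
def pauliZ : Op Bool := Matrix.diagonal fun b => if b then -1 else 1

/-- For `lam ≤ n`, the operator `Z^k ⊗ I_{n - lam}` on `n` qubits, where
`Z^k = Z^{k_1} ⊗ ⋯ ⊗ Z^{k_lam}` acts on the first `lam` qubits. -/
def phaseOp {lam : ℕ} (n : ℕ) (k : Bits lam) : Op (Bits n) :=
  tensorPi fun j : Fin n => if h : j.1 < lam then pauliZ ^ (k ⟨j.1, h⟩).toNat else 1

/-- The channel `|ϑ⟩ ↦ (Z^k ⊗ I_{n - lam}) |ϑ⟩`. -/
def phaseMap {lam : ℕ} (n : ℕ) (k : Bits lam) (ρ : Op (Bits n)) : Op (Bits n) :=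
  phaseOp n k * ρ * (phaseOp n k)ᴴ

end CHS

end

/-! Both averaged states are computed entry by entry in the computational basis. A Haar moment `mom
x y` is unchanged by diagonal unitaries, so it vanishes unless `y` has the same multiset of entries
as `x`; when `x` is injective and `y` permutes it, the moment is the inverse of the rising factorial
of the dimension `2 ^ n`, the same for every such pair. A real entry is such a moment over all `p *
ℓ + t` positions times the key averages `mask`; an ideal entry is a product of moments over the
separate blocks.

The average over a uniform key kills an entry unless, in every block, the XORs of the first `lam`
bits of the row and column labels agree. Call a tuple good if its entries are distinct and different
`ℓ`-subsets of positions have different XORs. On a good row the key average therefore leaves only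
permutations that preserve every block (`exists_block_perms`), which is the support of the ideal
row. There the two states differ by one scalar, `entryRatio`, which is at most 1
(`realStateMulti_eq_ratio_mul`).

Two states of trace one that are proportional in this way on the good rows differ by at most the
weight of the bad labels (`DiffBound.of_proportional`). With `m = p * ℓ + t`, repeated entries have
weight at most `m ^ 2 / 2 ^ n`, and a union bound over pairs of `ℓ`-subsets gives weight at most `m
^ (2 * ℓ) / 2 ^ lam` to XOR collisions (`sum_weight_not_good_le`). This yields both trace distance
bounds with constant 2 and bounds every distinguisher. Security follows because `ℓ * log lam =
o(lam)` keeps the numerator below `2 ^ (lam / 2)`, up to a polynomial factor. Efficiency holds since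
the construction is a row of controlled `Z` gates, printed by an explicit quadratic-time machine. -/

noncomputable section

namespace CHS

open scoped BigOperators Matrix Kronecker ComplexOrder

/-! ### The circuit of the construction and the machine that prints it -/

/-- Controlled `Z` from every key qubit to the state qubit with the same index. -/
def phaseCircuit (lam : ℕ) : Circuit :=
  (List.range lam).map fun i => Gate.cz ⟨Reg.key, i⟩ ⟨Reg.st, i⟩

theorem phaseCircuit_succ (s : ℕ) :
    phaseCircuit (s + 1) = phaseCircuit s ++ [Gate.cz ⟨Reg.key, s⟩ ⟨Reg.st, s⟩] := by
  simp [phaseCircuit, List.range_succ]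

/-- The stacks of the printer: a unary counter (initially the input), an auxiliary stack
on which the counter is saved while it is printed, and the output. -/
inductive PrinterStack
  | input | aux | output
  deriving DecidableEq

instance : Fintype PrinterStack :=
  ⟨{.input, .aux, .output}, fun k => by cases k <;> decide⟩

/-- The labels of the printer: start the next gate, print while moving the counter to the
auxiliary stack, print while moving it back. -/
inductive PrinterLabel
  | next | save | restore
  deriving DecidableEq

instance : Fintype PrinterLabel :=
  ⟨{.next, .save, .restore}, fun l => by cases l <;> decide⟩

/-- The stack alphabets of the printer. -/
def PrinterAlphabet : PrinterStack → Type
  | .output => Sym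
  | _ => Bool

open PrinterStack PrinterLabel Turing.TM2.Stmt in
/-- The program of the printer. -/
def printerProgram : PrinterLabel → Turing.TM2.Stmt PrinterAlphabet PrinterLabel Bool
  -- The output is a stack, so gates are emitted from the highest index down and each gate from its
  -- final separator back to its `cz`. The pop here also turns the counter into the index of the
  -- gate being written.
  | next => pop input (fun _ o => o.isSome) <| branch id
      (push output (fun _ => Sym.sep) <| goto fun _ => save) halt
  | save => pop input (fun _ o => o.isSome) <| branch id
      (push aux (fun _ => true) <| push output (fun _ => Sym.tick) <| goto fun _ => save)
      (push output (fun _ => Sym.st) <| push output (fun _ => Sym.sep) <| goto fun _ => restore)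
  | restore => pop aux (fun _ o => o.isSome) <| branch id
      (push input (fun _ => true) <| push output (fun _ => Sym.tick) <| goto fun _ => restore)
      (push output (fun _ => Sym.key) <| push output (fun _ => Sym.cz) <| goto fun _ => next)

/-- The Turing machine that prints `phaseCircuit lam` on input `1 ^ lam`. -/
def printer : Turing.FinTM2 where
  K := PrinterStack
  k₀ := .input
  k₁ := .output
  Γ := PrinterAlphabet
  Λ := PrinterLabel
  main := .next
  σ := Bool
  initialState := false
  Γk₀Fin := inferInstanceAs (Fintype Bool)
  m := printerProgram

/-- A list of `i` marks. -/
def marks (i : ℕ) : List Bool := List.replicate i true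

/-- The stack contents of the printer with counter `i`, saved counter `a` and output `o`. -/
def printerStacks (i a : ℕ) (o : List Sym) : ∀ k, List (PrinterAlphabet k)
  | .input => marks i
  | .aux => marks a
  | .output => o

/-- The configuration of the printer at label `l`. -/
def printerCfg (l : Option PrinterLabel) (v : Bool) (i a : ℕ) (o : List Sym) : printer.Cfg :=
  ⟨l, v, printerStacks i a o⟩

/-- In these transition lemmas only the stacks need an argument: the machine produces nested
updates, which agree with `printerStacks` stack by stack. -/
theorem step_next_succ (v : Bool) (i : ℕ) (o : List Sym) :
    printer.step (printerCfg (some .next) v (i + 1) 0 o) =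
      some (printerCfg (some .save) true i 0 (Sym.sep :: o)) := by
  show some _ = some _
  congr 1
  show Turing.TM2.Cfg.mk _ _ _ = Turing.TM2.Cfg.mk _ _ _
  congr 1
  funext k; cases k <;> rfl

theorem step_next_zero (v : Bool) (o : List Sym) :
    printer.step (printerCfg (some .next) v 0 0 o) = some (printerCfg none false 0 0 o) := by
  show some _ = some _
  congr 1
  show Turing.TM2.Cfg.mk _ _ _ = Turing.TM2.Cfg.mk _ _ _
  congr 1
  funext k; cases k <;> rfl

theorem step_save_succ (v : Bool) (i a : ℕ) (o : List Sym) :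
    printer.step (printerCfg (some .save) v (i + 1) a o) =
      some (printerCfg (some .save) true i (a + 1) (Sym.tick :: o)) := by
  show some _ = some _
  congr 1
  show Turing.TM2.Cfg.mk _ _ _ = Turing.TM2.Cfg.mk _ _ _
  congr 1
  funext k; cases k <;> rfl

theorem step_save_zero (v : Bool) (a : ℕ) (o : List Sym) :
    printer.step (printerCfg (some .save) v 0 a o) =
      some (printerCfg (some .restore) false 0 a (Sym.sep :: Sym.st :: o)) := by
  show some _ = some _
  congr 1
  show Turing.TM2.Cfg.mk _ _ _ = Turing.TM2.Cfg.mk _ _ _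
  congr 1
  funext k; cases k <;> rfl

theorem step_restore_succ (v : Bool) (i a : ℕ) (o : List Sym) :
    printer.step (printerCfg (some .restore) v i (a + 1) o) =
      some (printerCfg (some .restore) true (i + 1) a (Sym.tick :: o)) := by
  show some _ = some _
  congr 1
  show Turing.TM2.Cfg.mk _ _ _ = Turing.TM2.Cfg.mk _ _ _
  congr 1
  funext k; cases k <;> rfl

theorem step_restore_zero (v : Bool) (i : ℕ) (o : List Sym) :
    printer.step (printerCfg (some .restore) v i 0 o) =
      some (printerCfg (some .next) false i 0 (Sym.cz :: Sym.key :: o)) := by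
  show some _ = some _
  congr 1
  show Turing.TM2.Cfg.mk _ _ _ = Turing.TM2.Cfg.mk _ _ _
  congr 1
  funext k; cases k <;> rfl

/-- Iterated steps of the printer. -/
def printerRun (m : ℕ) (c : printer.Cfg) : Option printer.Cfg :=
  (flip bind printer.step)^[m] (some c)

theorem printerRun_succ {m : ℕ} {c d : printer.Cfg} (h : printer.step c = some d) :
    printerRun (m + 1) c = printerRun m d := by
  rw [printerRun, Function.iterate_succ_apply, printerRun]
  congr 1

theorem printerRun_save (v : Bool) (i a : ℕ) (o : List Sym) (m : ℕ) :
    ∃ v', printerRun (m + i) (printerCfg (some .save) v i a o) =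
      printerRun m (printerCfg (some .save) v' 0 (a + i) (List.replicate i Sym.tick ++ o)) := by
  induction i generalizing v a o with
  | zero => exact ⟨v, rfl⟩
  | succ i ih =>
    obtain ⟨v', h⟩ := ih true (a + 1) (Sym.tick :: o)
    refine ⟨v', ?_⟩
    rw [← add_assoc, printerRun_succ (step_save_succ v i a o), h, add_right_comm, add_assoc,
      List.replicate_succ', List.append_assoc]
    rfl

theorem printerRun_restore (v : Bool) (i a : ℕ) (o : List Sym) (m : ℕ) :
    ∃ v', printerRun (m + a) (printerCfg (some .restore) v i a o) =
      printerRun m (printerCfg (some .restore) v' (i + a) 0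
        (List.replicate a Sym.tick ++ o)) := by
  induction a generalizing v i o with
  | zero => exact ⟨v, rfl⟩
  | succ a ih =>
    obtain ⟨v', h⟩ := ih true (i + 1) (Sym.tick :: o)
    refine ⟨v', ?_⟩
    rw [← add_assoc, printerRun_succ (step_restore_succ v i a o), h, add_right_comm, add_assoc,
      List.replicate_succ', List.append_assoc]
    rfl

theorem encodeCircuit_phaseCircuit_succ (i : ℕ) (o : List Sym) :
    encodeCircuit (phaseCircuit (i + 1)) ++ o = encodeCircuit (phaseCircuit i) ++
      (Sym.cz :: Sym.key :: (List.replicate i Sym.tick ++ (Sym.sep :: Sym.st ::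
        (List.replicate i Sym.tick ++ (Sym.sep :: o))))) := by
  simp [phaseCircuit_succ, encodeCircuit, Gate.encode, Loc.encode, Reg.sym]

/-- The gate of index `i` costs `2 * i + 3` steps: `i` moves each way and three changes of label.
Summing these, plus the final halting step, gives the quadratic count. -/
theorem printerRun_next (v : Bool) (i : ℕ) (o : List Sym) :
    printerRun (i ^ 2 + 2 * i + 1) (printerCfg (some .next) v i 0 o) =
      some (printerCfg none false 0 0 (encodeCircuit (phaseCircuit i) ++ o)) := by
  induction i generalizing v o with
  | zero => exact step_next_zero v o
  | succ i ih =>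
    have hm : (i + 1) ^ 2 + 2 * (i + 1) + 1 =
        i ^ 2 + 2 * i + 1 + 1 + i + 1 + i + 1 := by ring
    rw [hm, printerRun_succ (step_next_succ v i o)]
    obtain ⟨v₁, h₁⟩ := printerRun_save true i 0 (Sym.sep :: o) (i ^ 2 + 2 * i + 1 + 1 + i + 1)
    rw [h₁, zero_add, printerRun_succ (step_save_zero v₁ i _)]
    obtain ⟨v₂, h₂⟩ := printerRun_restore false 0 i
      (Sym.sep :: Sym.st :: (List.replicate i Sym.tick ++ (Sym.sep :: o))) (i ^ 2 + 2 * i + 1 + 1)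
    rw [h₂, zero_add, printerRun_succ (step_restore_zero v₂ i _), ih,
      encodeCircuit_phaseCircuit_succ]

theorem unaryEncodeNat_eq (m : ℕ) : Computability.unaryEncodeNat m = marks m := by
  induction m with
  | zero => rfl
  | succ m ih => rw [Computability.unaryEncodeNat, ih]; rfl

theorem initList_printer (m : ℕ) :
    Turing.initList printer (marks m) = printerCfg (some .next) false m 0 [] := by
  show Turing.TM2.Cfg.mk _ _ _ = Turing.TM2.Cfg.mk _ _ _
  congr 1
  funext k; cases k <;> rfl

/-- A proper halting configuration has the register at its initial value and every stack but the
output empty; the failed pop that ends the run sets the register to `false`. -/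
theorem haltList_printer (o : List Sym) :
    Turing.haltList printer o = printerCfg none false 0 0 o := by
  show Turing.TM2.Cfg.mk _ _ _ = Turing.TM2.Cfg.mk _ _ _
  congr 1
  funext k; cases k <;> rfl

/-- The circuits `phaseCircuit lam` can be printed in polynomial time. -/
def phaseCircuitComputable :
    Turing.TM2ComputableInPolyTime Computability.unaryEncodeNat encodeCircuit phaseCircuit where
  tm := printer
  inputAlphabet := Equiv.refl Bool
  outputAlphabet := Equiv.refl Sym
  time := Polynomial.X ^ 2 + 2 * Polynomial.X + 1
  outputsFun m :=
    { steps := m ^ 2 + 2 * m + 1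
      evals_in_steps := by
        have hin : List.map (Equiv.refl Bool).invFun (Computability.unaryEncodeNat m) =
            marks m := by rw [unaryEncodeNat_eq]; exact List.map_id _
        have hout : List.map (Equiv.refl Sym).invFun (encodeCircuit (phaseCircuit m)) =
            encodeCircuit (phaseCircuit m) ++ [] := by
          rw [List.append_nil]; exact List.map_id _
        refine Eq.trans (congrArg (fun l => printerRun _ (Turing.initList printer l)) hin)
          (Eq.trans ?_ (congrArg (fun l => some (Turing.haltList printer l)) hout).symm)
        rw [initList_printer, haltList_printer, printerRun_next]
      steps_le_m := by
        simp [unaryEncodeNat_eq, marks] }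

/-! ### The phase channel -/

/-- The sign of the bit `b`. -/
def bitSign (b : Bool) : ℤˣ := if b then -1 else 1

/-- The diagonal entries of `Z^k ⊗ I`. -/
def phaseSign {lam : ℕ} (n : ℕ) (k : Bits lam) (x : Bits n) : ℤˣ :=
  ∏ j : Fin n, if h : j.1 < lam then bitSign (k ⟨j.1, h⟩ && x j) else 1

theorem pauliZ_pow (b : Bool) :
    pauliZ ^ b.toNat = Matrix.diagonal fun a => ((bitSign (b && a) : ℤ) : ℂ) := by
  cases b
  · ext i j; cases i <;> cases j <;> simp [bitSign]
  · ext i j; cases i <;> cases j <;> simp [bitSign, pauliZ]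

theorem tensorPi_diagonal {κ ι : Type} [Fintype κ] [DecidableEq ι] [DecidableEq (κ → ι)]
    (d : κ → ι → ℂ) :
    tensorPi (fun i => Matrix.diagonal (d i)) = Matrix.diagonal fun x => ∏ i, d i (x i) := by
  ext x y
  rw [tensorPi, Matrix.of_apply]
  by_cases h : x = y
  · subst h; simp
  · rw [Matrix.diagonal_apply_ne _ h]
    obtain ⟨i, hi⟩ := Function.ne_iff.1 h
    exact Finset.prod_eq_zero (Finset.mem_univ i) (Matrix.diagonal_apply_ne _ hi)

theorem phaseOp_eq {lam : ℕ} (n : ℕ) (k : Bits lam) :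
    phaseOp n k = Matrix.diagonal fun x => ((phaseSign n k x : ℤ) : ℂ) := by
  have : phaseOp n k = tensorPi fun j : Fin n => Matrix.diagonal fun a =>
      (((if h : j.1 < lam then bitSign (k ⟨j.1, h⟩ && a) else 1 : ℤˣ) : ℤ) : ℂ) := by
    unfold phaseOp
    congr 1
    funext j
    split_ifs with h
    · rw [pauliZ_pow]
    · simp
  rw [this, tensorPi_diagonal]
  congr 1
  funext x
  simp only [phaseSign, Units.coe_prod, Int.cast_prod]

theorem phaseMap_apply {lam : ℕ} (n : ℕ) (k : Bits lam) (ρ : Op (Bits n)) (x y : Bits n) :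
    phaseMap n k ρ x y =
      ((phaseSign n k x : ℤ) : ℂ) * ρ x y * ((phaseSign n k y : ℤ) : ℂ) := by
  rw [phaseMap, phaseOp_eq, Matrix.diagonal_conjTranspose, Matrix.mul_diagonal,
    Matrix.diagonal_mul]
  simp

theorem sign_mul_self (u : ℤˣ) : ((u : ℤ) : ℂ) * ((u : ℤ) : ℂ) = 1 := by
  rw [← Int.cast_mul, ← Units.val_mul, Int.units_mul_self]; simp

theorem phaseMap_isChannel {lam : ℕ} (n : ℕ) (k : Bits lam) : IsChannel (phaseMap n k) := by
  refine ⟨1, fun _ => phaseOp n k, ?_, fun ρ => by simp [phaseMap]⟩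
  rw [Fin.sum_univ_one, phaseOp_eq, Matrix.diagonal_conjTranspose, Matrix.diagonal_mul_diagonal,
    ← Matrix.diagonal_one]
  congr 1
  funext x
  simp [sign_mul_self]

theorem phaseMap_pure {lam : ℕ} (n : ℕ) (k : Bits lam) (ϑ : PureState n) :
    ∃ ϑ' : PureState n, phaseMap n k ϑ.density = ϑ'.density := by
  refine ⟨⟨WithLp.toLp 2 fun x => ((phaseSign n k x : ℤ) : ℂ) * ϑ.1 x, ?_⟩, ?_⟩
  · have h := ϑ.2
    rw [mem_sphere_zero_iff_norm, EuclideanSpace.norm_eq] at h ⊢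
    refine Eq.trans (congrArg Real.sqrt (Finset.sum_congr rfl fun x _ => ?_)) h
    rcases Int.units_eq_one_or (phaseSign n k x) with h | h <;> simp [h]
  · ext x y
    rw [phaseMap_apply]
    simp only [PureState.density, Matrix.of_apply, star_mul', star_intCast]
    ring

theorem diagonal_foldl {ι α : Type} [Fintype ι] [DecidableEq ι] (L : List α) (d : α → ι → ℂ)
    (e : ι → ℂ) :
    L.foldl (fun U g => Matrix.diagonal (d g) * U) (Matrix.diagonal e) =
      Matrix.diagonal fun x => (L.map fun g => d g x).prod * e x := by
  induction L generalizing e with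
  | nil => simp
  | cons g L ih =>
    rw [List.foldl_cons, Matrix.diagonal_mul_diagonal, ih]
    congr 1
    funext x
    rw [List.map_cons, List.prod_cons]
    ring

/-- Every gate is diagonal, so the circuit multiplies the signs of its gates. -/
theorem phaseCircuit_op {lam n : ℕ} (a : ℕ) (hn : lam ≤ n) :
    (phaseCircuit lam).op lam n a = Matrix.diagonal fun x : Wire lam n a → Bool =>
      (((∏ i : Fin lam, bitSign (x (Sum.inl i) && x (Sum.inr (Sum.inl (i.castLE hn)))) : ℤˣ) :
        ℤ) : ℂ) := by
  have h1 : phaseCircuit lam = (List.finRange lam).map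
      fun i : Fin lam => Gate.cz ⟨Reg.key, i.1⟩ ⟨Reg.st, i.1⟩ := by
    rw [phaseCircuit, ← List.map_coe_finRange_eq_range, List.map_map]; rfl
  have h2 : ∀ i : Fin lam, (Gate.cz ⟨Reg.key, i⟩ ⟨Reg.st, i⟩).op lam n a =
      Matrix.diagonal fun x =>
        ((bitSign (x (Sum.inl i) && x (Sum.inr (Sum.inl (i.castLE hn)))) : ℤ) : ℂ) := by
    intro i
    have hi : i.1 < n := i.2.trans_le hn
    simp only [Gate.op, Loc.wire, i.2, hi, dif_pos, czOp]
    rw [if_neg (by simp)]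
    congr 1
    funext x
    simp only [bitSign, Fin.castLE]
    split_ifs <;> simp
  rw [Circuit.op, h1, List.foldl_map, ← Matrix.diagonal_one]
  rw [funext fun U => funext fun i => congrArg (· * U) (h2 i), diagonal_foldl]
  congr 1
  funext x
  rw [mul_one, ← Fin.prod_univ_def]
  simp only [Units.coe_prod, Int.cast_prod]

theorem phaseCircuit_ancillas (lam : ℕ) : (phaseCircuit lam).ancillas = 0 := by
  have : ∀ L : List ℕ, Circuit.ancillas (L.map fun i => Gate.cz ⟨Reg.key, i⟩ ⟨Reg.st, i⟩) = 0 := by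
    intro L
    induction L with
    | nil => rfl
    | cons i L ih =>
      rw [Circuit.ancillas] at ih ⊢
      simpa [Gate.locs] using ih
  exact this _

theorem phaseSign_eq {lam n : ℕ} (hn : lam ≤ n) (k : Bits lam) (x : Bits n) :
    phaseSign n k x = ∏ i : Fin lam, bitSign (k i && x (i.castLE hn)) := by
  symm
  rw [phaseSign]
  refine Finset.prod_of_injOn (Fin.castLE hn) (fun i _ j _ h => Fin.castLE_injective hn h)
    (fun _ _ => Finset.mem_coe.2 (Finset.mem_univ _)) ?_ ?_
  · intro j _ hj
    rw [dif_neg]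
    intro h
    exact hj ⟨⟨j, h⟩, Finset.mem_coe.2 (Finset.mem_univ _), rfl⟩
  · intro i _
    rw [dif_pos (show (i.castLE hn).1 < lam from i.2)]
    rfl

theorem phaseCircuit_runWith {lam n : ℕ} (hn : lam ≤ n) (k : Bits lam) (ρ : Op (Bits n)) :
    runWith 0 (phaseCircuit lam) k ρ = phaseMap n k ρ := by
  ext x y
  rw [phaseMap_apply, runWith, traceOut, Matrix.of_apply, phaseCircuit_op 0 hn,
    Finset.sum_eq_single k]
  · rw [Fintype.sum_unique, Matrix.diagonal_conjTranspose, Matrix.mul_diagonal,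
      Matrix.diagonal_mul, inputOp, Matrix.of_apply, if_pos]
    · rw [phaseSign_eq hn, phaseSign_eq hn]
      simp [joinBits]
    · simp [joinBits]
  -- A diagonal circuit leaves the key register in the basis state `k`, so other key labels
  -- contribute nothing to the partial trace.
  · intro k' _ hk
    refine Finset.sum_eq_zero fun z _ => ?_
    rw [Matrix.diagonal_conjTranspose, Matrix.mul_diagonal, Matrix.diagonal_mul, inputOp,
      Matrix.of_apply, if_neg]
    · simp
    · rintro ⟨⟨h, -⟩, -⟩
      exact hk h
  · simp

theorem phaseMap_isQPT {n : ℕ → ℕ} (hn : ∀ lam, lam ≤ n lam) :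
    IsQPT (n := n) fun lam k => phaseMap (lam := lam) (n lam) k := by
  refine ⟨phaseCircuit, ⟨phaseCircuitComputable⟩, fun lam k ρ => ?_⟩
  rw [Circuit.run, phaseCircuit_ancillas, phaseCircuit_runWith (hn lam)]

/-! ### Trace distance and distinguishing advantage -/

section TraceNorm

variable {ι : Type} [Fintype ι]

theorem charpoly_conjTranspose_mul_self [DecidableEq ι] {X : Op ι} (hX : X.IsHermitian) :
    (Xᴴ * X).charpoly =
      ∏ i, (Polynomial.X - Polynomial.C (((hX.eigenvalues i) ^ 2 : ℝ) : ℂ)) := by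
  have h : Xᴴ * X = Unitary.conjStarAlgAut ℂ _ hX.eigenvectorUnitary
      (Matrix.diagonal fun i => (((hX.eigenvalues i) ^ 2 : ℝ) : ℂ)) := by
    rw [hX.eq]
    conv_lhs => rw [hX.spectral_theorem, ← map_mul, Matrix.diagonal_mul_diagonal]
    congr 2
    funext i
    simp [pow_two]
  rw [h, Unitary.conjStarAlgAut_apply, Matrix.charpoly_mul_comm, ← mul_assoc]
  simp [Matrix.charpoly_diagonal]

/-- `Xᴴ * X` has the squared eigenvalues of `X`. The comparison goes through roots of characteristic
polynomials, as multisets, because the two enumerations of eigenvalues need not match. -/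
theorem traceNorm_eq_sum_abs_eigenvalues [DecidableEq ι] {X : Op ι} (hX : X.IsHermitian) :
    traceNorm X = ∑ i, |hX.eigenvalues i| := by
  have h1 := (Matrix.isHermitian_conjTranspose_mul_self X).roots_charpoly_eq_eigenvalues
  rw [charpoly_conjTranspose_mul_self hX, Polynomial.roots_prod _ _
    (Finset.prod_ne_zero_iff.2 fun i _ => Polynomial.X_sub_C_ne_zero _)] at h1
  simp only [Polynomial.roots_X_sub_C, Multiset.bind_singleton] at h1
  have h2 := congrArg (fun s : Multiset ℂ => (s.map fun z => √z.re).sum) h1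
  simp only [Multiset.map_map, Function.comp_def, Complex.ofReal_re, RCLike.ofReal_eq_complex_ofReal,
    Real.sqrt_sq_eq_abs] at h2
  exact h2.symm

theorem sum_eigenvectorBasis_eq_trace [DecidableEq ι] {X : Op ι} (hX : X.IsHermitian) (P : Op ι) :
    ∑ i, (star ⇑(hX.eigenvectorBasis i) ⬝ᵥ (P *ᵥ ⇑(hX.eigenvectorBasis i))) = P.trace := by
  set U : Op ι := (hX.eigenvectorUnitary : Matrix.unitaryGroup ι ℂ).1 with hU
  have h : (Uᴴ * P * U).trace = P.trace := by
    rw [Matrix.trace_mul_comm, ← mul_assoc]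
    have : U * Uᴴ = 1 := Unitary.mul_star_self_of_mem hX.eigenvectorUnitary.2
    rw [this, one_mul]
  rw [← h, Matrix.trace]
  refine Finset.sum_congr rfl fun i _ => ?_
  rw [Matrix.diag_apply, mul_assoc, Matrix.mul_apply]
  rfl

/-- In an eigenbasis of `P - Q` each eigenvalue is a difference of two nonnegative expectations,
hence at most their sum in absolute value; the expectations sum to the traces. -/
theorem traceNorm_sub_le [DecidableEq ι] {P Q : Op ι} (hP : P.PosSemidef) (hQ : Q.PosSemidef) :
    traceNorm (P - Q) ≤ P.trace.re + Q.trace.re := by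
  have hX : (P - Q).IsHermitian := hP.1.sub hQ.1
  rw [traceNorm_eq_sum_abs_eigenvalues hX, ← sum_eigenvectorBasis_eq_trace hX P,
    ← sum_eigenvectorBasis_eq_trace hX Q, Complex.re_sum, Complex.re_sum, ← Finset.sum_add_distrib]
  refine Finset.sum_le_sum fun i _ => ?_
  rw [hX.eigenvalues_eq, Matrix.sub_mulVec, dotProduct_sub]
  have h1 := hP.re_dotProduct_nonneg (hX.eigenvectorBasis i)
  have h2 := hQ.re_dotProduct_nonneg (hX.eigenvectorBasis i)
  simp only [RCLike.re_eq_complex_re, Complex.sub_re] at h1 h2 ⊢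
  rw [abs_le]
  constructor <;> linarith

theorem trace_mul_nonneg {M P : Op ι} (hM : M.PosSemidef) (hP : P.PosSemidef) :
    0 ≤ (M * P).trace.re := by
  obtain ⟨m, v, rfl⟩ := Matrix.posSemidef_iff_eq_sum_vecMulVec.1 hP
  rw [Finset.mul_sum, Matrix.trace_sum, Complex.re_sum]
  refine Finset.sum_nonneg fun i _ => ?_
  rw [Matrix.mul_vecMulVec, Matrix.trace_vecMulVec, dotProduct_comm]
  exact hM.re_dotProduct_nonneg (v i)

/-- The difference `R - S` is a difference of positive operators of the same trace, which is at
most `ε`. -/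
def DiffBound (R S : Op ι) (ε : ℝ) : Prop :=
  ∃ P Q : Op ι, P.PosSemidef ∧ Q.PosSemidef ∧ R - S = P - Q ∧ P.trace = Q.trace ∧ P.trace.re ≤ ε

theorem DiffBound.mono {R S : Op ι} {ε δ : ℝ} (h : DiffBound R S ε) (hεδ : ε ≤ δ) :
    DiffBound R S δ := by
  obtain ⟨P, Q, hP, hQ, h1, h2, h3⟩ := h
  exact ⟨P, Q, hP, hQ, h1, h2, h3.trans hεδ⟩

theorem DiffBound.refl (R : Op ι) : DiffBound R R 0 :=
  ⟨0, 0, .zero, .zero, by simp, rfl, by simp⟩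

theorem DiffBound.traceDist_le [DecidableEq ι] {R S : Op ι} {ε : ℝ} (h : DiffBound R S ε) :
    traceDist R S ≤ ε := by
  obtain ⟨P, Q, hP, hQ, h1, h2, h3⟩ := h
  have := traceNorm_sub_le hP hQ
  rw [traceDist, h1]
  rw [← h2] at this
  linarith

/-- Both `Tr (M P)` and `Tr (M Q)` lie between 0 and the common trace, since `M` and `1 - M` are
positive. -/
theorem DiffBound.prob_le [DecidableEq ι] {R S : Op ι} {ε : ℝ} (h : DiffBound R S ε) (A : Test ι) :
    |A.prob R - A.prob S| ≤ ε := by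
  obtain ⟨P, Q, hP, hQ, h1, h2, h3⟩ := h
  have e : A.prob R - A.prob S = (A.M * P).trace.re - (A.M * Q).trace.re := by
    rw [Test.prob, Test.prob, ← Complex.sub_re, ← Complex.sub_re, ← Matrix.trace_sub,
      ← Matrix.trace_sub, ← mul_sub, ← mul_sub, h1]
  have key : ∀ X : Op ι, X.PosSemidef → 0 ≤ (A.M * X).trace.re ∧
      (A.M * X).trace.re ≤ X.trace.re := by
    intro X hX
    refine ⟨trace_mul_nonneg A.pos hX, ?_⟩
    have := trace_mul_nonneg A.le_one hX
    rw [sub_mul, one_mul, Matrix.trace_sub, Complex.sub_re] at this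
    linarith
  have hp := key P hP
  have hq := key Q hQ
  rw [← h2] at hq
  rw [e, abs_le]
  constructor <;> linarith

theorem DiffBound.submatrix {κ : Type} [Fintype κ] {R S : Op ι} {ε : ℝ}
    (h : DiffBound R S ε) (e : κ ≃ ι) : DiffBound (R.submatrix e e) (S.submatrix e e) ε := by
  obtain ⟨P, Q, hP, hQ, h1, h2, h3⟩ := h
  have ht : ∀ X : Op ι, (X.submatrix e e).trace = X.trace := fun X =>
    Equiv.sum_comp e fun i => X i i
  refine ⟨P.submatrix e e, Q.submatrix e e, hP.submatrix e, hQ.submatrix e, ?_, ?_, ?_⟩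
  · ext x y
    exact congrFun (congrFun h1 (e x)) (e y)
  · rw [ht, ht, h2]
  · rwa [ht]

/-- The compression of an operator to the span of the basis vectors satisfying `p`. -/
def compress (p : ι → Prop) [DecidablePred p] (X : Op ι) : Op ι :=
  Matrix.of fun x y => if p x ∧ p y then X x y else 0

theorem compress_posSemidef [DecidableEq ι] (p : ι → Prop) [DecidablePred p] {X : Op ι} (hX : X.PosSemidef) :
    (compress p X).PosSemidef := by
  have h : compress p X = (Matrix.diagonal fun x => if p x then (1 : ℂ) else 0)ᴴ * X *
      Matrix.diagonal fun x => if p x then (1 : ℂ) else 0 := by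
    ext x y
    rw [Matrix.diagonal_conjTranspose, Matrix.mul_diagonal, Matrix.diagonal_mul]
    by_cases hx : p x <;> by_cases hy : p y <;> simp [compress, hx, hy]
  rw [h]
  exact hX.conjTranspose_mul_mul_same _

/-- If the rows of two states with labels satisfying `p` agree up to a scalar in `[0, 1]`, then
their difference is bounded by the weight of the remaining labels. -/
theorem DiffBound.of_proportional [DecidableEq ι] {R S : Op ι} (hR : R.PosSemidef) (hS : S.PosSemidef)
    (htr : R.trace = S.trace) (p : ι → Prop) [DecidablePred p] {α : ℝ} (hα : α ≤ 1)
    (hRS : ∀ x y, p x → R x y = α * S x y) (h0 : ∀ x y, p x → ¬ p y → S x y = 0) :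
    DiffBound R S (∑ x with ¬ p x, (R x x).re) := by
  have hR0 : ∀ x y, p x → ¬ p y → R x y = 0 := fun x y hx hy => by rw [hRS x y hx, h0 x y hx hy, mul_zero]
  -- Both operators are block diagonal for the splitting by `p`. On the `p` block the difference is
  -- `-(1 - α) S`, which is negative because `α ≤ 1`.
  have hd : R - S = compress (fun x => ¬ p x) R -
      ((((1 - α : ℝ) : ℂ) • compress p S) + compress (fun x => ¬ p x) S) := by
    ext x y
    simp only [Matrix.sub_apply, Matrix.add_apply, Matrix.smul_apply, compress, Matrix.of_apply,
      smul_eq_mul]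
    by_cases hx : p x <;> by_cases hy : p y
    · simp [hx, hy, hRS x y hx]; ring
    · simp [hx, hy, hR0 x y hx hy, h0 x y hx hy]
    · have h1 := hR.1.apply x y
      have h2 := hS.1.apply x y
      rw [hR0 y x hy hx, star_zero] at h1
      rw [h0 y x hy hx, star_zero] at h2
      simp [hx, hy, ← h1, ← h2]
    · simp [hx, hy]
  refine ⟨_, _, compress_posSemidef _ hR, ?_, hd, ?_, ?_⟩
  · refine Matrix.PosSemidef.add ?_ (compress_posSemidef _ hS)
    refine (compress_posSemidef p hS).smul ?_
    rw [← Complex.ofReal_zero]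
    exact Complex.real_le_real.2 (by linarith)
  -- The negative part is never estimated: its trace equals that of the positive part because `R`
  -- and `S` have equal trace.
  · have := congrArg Matrix.trace hd
    rw [Matrix.trace_sub, htr, sub_self, Matrix.trace_sub] at this
    exact sub_eq_zero.1 this.symm
  · rw [Matrix.trace, Complex.re_sum, Finset.sum_filter]
    refine (Finset.sum_le_sum fun x _ => ?_)
    by_cases hx : p x <;> simp [compress, hx]

end TraceNorm

/-! ### Invariance of the Haar distribution -/

section Haar

open MeasureTheory

variable {n : ℕ}

/-- The real linear isometries of the `n`-qubit Hilbert space. -/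
abbrev Isom (n : ℕ) : Type := EuclideanSpace ℂ (Bits n) ≃ₗᵢ[ℝ] EuclideanSpace ℂ (Bits n)

/-- The action of isometries on pure states. -/
def PureState.act (U : Isom n) (ϑ : PureState n) : PureState n :=
  ⟨U ϑ.1, by rw [mem_sphere_zero_iff_norm, U.norm_map]; exact norm_eq_of_mem_sphere ϑ⟩

theorem PureState.continuous_act (U : Isom n) : Continuous (PureState.act U) :=
  (U.continuous.comp continuous_subtype_val).subtype_mk _

-- The sphere measure of `s` is, up to a fixed factor, the volume of the cone over `s`; an isometry
-- carries cones to cones and preserves volume.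
open scoped Pointwise in
theorem toSphere_preimage_act (U : Isom n) {s : Set (PureState n)} (hs : MeasurableSet s) :
    (volume : Measure (EuclideanSpace ℂ (Bits n))).toSphere (PureState.act U ⁻¹' s) =
      (volume : Measure (EuclideanSpace ℂ (Bits n))).toSphere s := by
  rw [Measure.toSphere_apply' _ ((PureState.continuous_act U).measurable hs),
    Measure.toSphere_apply' _ hs]
  congr 1
  have h : Set.Ioo (0 : ℝ) 1 • ((fun ϑ : PureState n => ϑ.1) '' (PureState.act U ⁻¹' s)) =
      U ⁻¹' (Set.Ioo (0 : ℝ) 1 • ((fun ϑ : PureState n => ϑ.1) '' s)) := by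
    ext v
    constructor
    · rintro ⟨r, hr, _, ⟨ϑ, hϑ, rfl⟩, rfl⟩
      exact ⟨r, hr, _, ⟨_, hϑ, rfl⟩, (U.map_smul r ϑ.1).symm⟩
    · rintro ⟨r, hr, _, ⟨ϑ, hϑ, rfl⟩, h⟩
      refine ⟨r, hr, _, ⟨PureState.act U.symm ϑ, ?_, rfl⟩, ?_⟩
      · have : PureState.act U (PureState.act U.symm ϑ) = ϑ :=
          Subtype.ext (U.apply_symm_apply ϑ.1)
        rwa [Set.mem_preimage, this]
      · have h' : r • ϑ.1 = U v := h
        show r • U.symm ϑ.1 = v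
        rw [← U.symm.map_smul, h', U.symm_apply_apply]
  exact (congrArg _ h).trans
    (U.measurePreserving.measure_preimage_equiv (f := U.toHomeomorph.toMeasurableEquiv) _)

theorem haarState_map_act (U : Isom n) :
    (haarState n).map (PureState.act U) = haarState n := by
  ext s hs
  rw [Measure.map_apply (PureState.continuous_act U).measurable hs, haarState,
    Measure.smul_apply, Measure.smul_apply, toSphere_preimage_act U hs]

theorem integral_isom {F : Type} [NormedAddCommGroup F] [NormedSpace ℝ F] (U : Isom n)
    {f : EuclideanSpace ℂ (Bits n) → F} (hf : Continuous f) :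
    ∫ ϑ : PureState n, f (U ϑ.1) ∂haarState n = ∫ ϑ : PureState n, f ϑ.1 ∂haarState n := by
  conv_rhs => rw [← haarState_map_act U]
  exact (integral_map (PureState.continuous_act U).measurable.aemeasurable
    (hf.comp continuous_subtype_val).stronglyMeasurable.aestronglyMeasurable).symm

theorem integrable_of_continuous {Ω F : Type} [TopologicalSpace Ω] [CompactSpace Ω]
    [MeasurableSpace Ω] [OpensMeasurableSpace Ω] [NormedAddCommGroup F]
    {μ : Measure Ω} [IsFiniteMeasure μ] {f : Ω → F} (hf : Continuous f) : Integrable f μ :=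
  hf.integrable_of_hasCompactSupport (HasCompactSupport.of_compactSpace f)

@[fun_prop]
theorem continuous_coord (b : Bits n) : Continuous fun v : EuclideanSpace ℂ (Bits n) => v b :=
  (EuclideanSpace.proj b : EuclideanSpace ℂ (Bits n) →L[ℂ] ℂ).continuous

/-- Permutations of the basis. -/
def permIsom (σ : Equiv.Perm (Bits n)) : Isom n :=
  LinearIsometryEquiv.piLpCongrLeft 2 ℝ ℂ σ

theorem permIsom_apply (σ : Equiv.Perm (Bits n)) (v : EuclideanSpace ℂ (Bits n)) (b : Bits n) :
    permIsom σ v b = v (σ.symm b) := by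
  rfl

/-- Diagonal unitaries. -/
def phaseIsom (u : Bits n → Circle) : Isom n :=
  LinearIsometryEquiv.piLpCongrRight 2 fun b => rotation (u b)

theorem phaseIsom_apply (u : Bits n → Circle) (v : EuclideanSpace ℂ (Bits n)) (b : Bits n) :
    phaseIsom u v b = u b * v b := by
  rfl

/-- A rotation by 45 degrees (composed with a reflection) in the plane of two basis vectors. -/
def mixFun (b c : Bits n) (v : EuclideanSpace ℂ (Bits n)) : EuclideanSpace ℂ (Bits n) :=
  WithLp.toLp 2 fun a => if a = b then (v b + v c) / (√2 : ℝ) else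
    if a = c then (v b - v c) / (√2 : ℝ) else v a

theorem sqrt_two_mul_self : ((√2 : ℝ) : ℂ) * ((√2 : ℝ) : ℂ) = 2 := by
  rw [← Complex.ofReal_mul, Real.mul_self_sqrt (by norm_num)]; norm_num

theorem sqrt_two_ne_zero : ((√2 : ℝ) : ℂ) ≠ 0 := by
  rw [Ne, Complex.ofReal_eq_zero]; positivity

theorem mixFun_involutive {b c : Bits n} (hbc : b ≠ c) : Function.Involutive (mixFun b c) := by
  intro v
  have h2 := sqrt_two_mul_self
  have h0 := sqrt_two_ne_zero
  ext a
  simp only [mixFun]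
  by_cases hab : a = b
  · subst hab
    simp only [if_true, if_neg hbc.symm]
    field_simp
    rw [pow_two, h2]
    ring
  · by_cases hac : a = c
    · subst hac
      simp only [if_true, if_neg hab]
      field_simp
      rw [pow_two, h2]
      ring
    · simp [hab, hac]

theorem mixFun_norm {b c : Bits n} (hbc : b ≠ c) (v : EuclideanSpace ℂ (Bits n)) :
    ‖mixFun b c v‖ = ‖v‖ := by
  rw [EuclideanSpace.norm_eq, EuclideanSpace.norm_eq]
  congr 1
  have hc : c ∈ Finset.univ.erase b := Finset.mem_erase.2 ⟨hbc.symm, Finset.mem_univ _⟩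
  rw [← Finset.add_sum_erase _ _ (Finset.mem_univ b), ← Finset.add_sum_erase _ _ hc,
    ← Finset.add_sum_erase Finset.univ (fun a => ‖v a‖ ^ 2) (Finset.mem_univ b),
    ← Finset.add_sum_erase _ (fun a => ‖v a‖ ^ 2) hc, ← add_assoc, ← add_assoc]
  congr 1
  · simp only [mixFun, if_true, if_neg hbc.symm, norm_div, Complex.norm_real, div_pow,
      Real.norm_eq_abs, sq_abs, Real.sq_sqrt (show (0 : ℝ) ≤ 2 by norm_num), Complex.sq_norm,
      Complex.normSq_apply, Complex.add_re, Complex.add_im, Complex.sub_re, Complex.sub_im]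
    ring
  · refine Finset.sum_congr rfl fun a ha => ?_
    have h1 := Finset.ne_of_mem_erase ha
    have h2 := Finset.ne_of_mem_erase (Finset.mem_of_mem_erase ha)
    simp [mixFun, h1, h2]

/-- `mixFun` as an isometry. -/
def mixIsom {b c : Bits n} (hbc : b ≠ c) : Isom n where
  toLinearEquiv := LinearEquiv.ofInvolutive
    { toFun := mixFun b c
      map_add' := fun v w => by
        ext a
        simp only [mixFun, PiLp.add_apply]
        split_ifs <;> ring
      map_smul' := fun r v => by
        ext a
        simp only [mixFun, PiLp.smul_apply, Complex.real_smul, RingHom.id_apply]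
        split_ifs <;> ring } (mixFun_involutive hbc)
  norm_map' := mixFun_norm hbc

theorem mixIsom_apply {b c : Bits n} (hbc : b ≠ c) (v : EuclideanSpace ℂ (Bits n)) :
    mixIsom hbc v = mixFun b c v := rfl

/-! ### Moments of Haar random states -/

theorem sum_sq_norm (ϑ : PureState n) : ∑ b, ‖ϑ.1 b‖ ^ 2 = 1 := by
  have h := norm_eq_of_mem_sphere ϑ
  rw [EuclideanSpace.norm_eq, Real.sqrt_eq_one] at h
  exact h

/-- The moment `E ∏_{b ∈ S} |ϑ_b|²`. -/
def sqMoment (S : Finset (Bits n)) : ℝ :=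
  ∫ ϑ : PureState n, ∏ b ∈ S, ‖ϑ.1 b‖ ^ 2 ∂haarState n

theorem integral_swap_sq {S : Finset (Bits n)} {b c : Bits n} (hb : b ∉ S) (hc : c ∉ S) (m : ℕ) :
    ∫ ϑ : PureState n, ‖ϑ.1 b‖ ^ m * ∏ a ∈ S, ‖ϑ.1 a‖ ^ 2 ∂haarState n =
      ∫ ϑ : PureState n, ‖ϑ.1 c‖ ^ m * ∏ a ∈ S, ‖ϑ.1 a‖ ^ 2 ∂haarState n := by
  rw [← integral_isom (permIsom (Equiv.swap b c))
    (f := fun v => ‖v b‖ ^ m * ∏ a ∈ S, ‖v a‖ ^ 2) (by fun_prop)]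
  refine integral_congr_ae (Filter.Eventually.of_forall fun ϑ => ?_)
  simp only [permIsom_apply, Equiv.symm_swap, Equiv.swap_apply_left]
  congr 1
  refine Finset.prod_congr rfl fun a ha => ?_
  have hab : a ≠ b := fun h => hb (h ▸ ha)
  have hac : a ≠ c := fun h => hc (h ▸ ha)
  rw [Equiv.swap_apply_of_ne_of_ne hab hac]

/-- Mixing the coordinates `b` and `c` turns `|b|² |c|²` into `|b + c|² |b - c|² / 4 = |b² - c²|² /
4`. The phase `c ↦ i c` shows that `|b² + c²|²` has the same weighted integral, and by the
parallelogram law the two sum to `2 |b|⁴ + 2 |c|⁴`. -/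
theorem integral_fourth_power {S : Finset (Bits n)} {b c : Bits n} (hbc : b ≠ c) (hb : b ∉ S)
    (hc : c ∉ S) :
    ∫ ϑ : PureState n, ‖ϑ.1 b‖ ^ 4 * ∏ a ∈ S, ‖ϑ.1 a‖ ^ 2 ∂haarState n =
      2 * ∫ ϑ : PureState n, ‖ϑ.1 b‖ ^ 2 * ‖ϑ.1 c‖ ^ 2 * ∏ a ∈ S, ‖ϑ.1 a‖ ^ 2 ∂haarState n := by
  set w : EuclideanSpace ℂ (Bits n) → ℝ := fun v => ∏ a ∈ S, ‖v a‖ ^ 2 with hw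
  have hwc : Continuous w := by fun_prop
  set F : EuclideanSpace ℂ (Bits n) → ℝ :=
    fun v => ‖v b + v c‖ ^ 2 * ‖v b - v c‖ ^ 2 * w v with hF
  have hFc : Continuous F := by fun_prop
  set u : Bits n → Circle := fun a => if a = c then ⟨Complex.I, by simp [Submonoid.unitSphere]⟩ else 1 with hu
  have hne : ∀ a ∈ S, a ≠ b ∧ a ≠ c := fun a ha => ⟨fun h => hb (h ▸ ha), fun h => hc (h ▸ ha)⟩
  have h1 : ∫ ϑ : PureState n, ‖ϑ.1 b‖ ^ 2 * ‖ϑ.1 c‖ ^ 2 * w ϑ.1 ∂haarState n =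
      (∫ ϑ : PureState n, F ϑ.1 ∂haarState n) / 4 := by
    rw [← integral_isom (mixIsom hbc) (f := fun v => ‖v b‖ ^ 2 * ‖v c‖ ^ 2 * w v) (by fun_prop),
      ← integral_div]
    refine integral_congr_ae (Filter.Eventually.of_forall fun ϑ => ?_)
    have e : w (mixFun b c ϑ.1) = w ϑ.1 := by
      refine Finset.prod_congr rfl fun a ha => ?_
      simp [mixFun, hne a ha]
    simp only [mixIsom_apply, e, hF]
    simp only [mixFun, if_true, if_neg hbc.symm, norm_div, Complex.norm_real, div_pow,
      Real.norm_eq_abs, sq_abs, Real.sq_sqrt (show (0 : ℝ) ≤ 2 by norm_num)]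
    ring
  have h2 : ∫ ϑ : PureState n, F (phaseIsom u ϑ.1) ∂haarState n =
      ∫ ϑ : PureState n, F ϑ.1 ∂haarState n := integral_isom _ hFc
  have h3 : ∀ ϑ : PureState n, F ϑ.1 + F (phaseIsom u ϑ.1) =
      2 * (‖ϑ.1 b‖ ^ 4 * w ϑ.1) + 2 * (‖ϑ.1 c‖ ^ 4 * w ϑ.1) := by
    intro ϑ
    have e : w (phaseIsom u ϑ.1) = w ϑ.1 := by
      refine Finset.prod_congr rfl fun a ha => ?_
      simp [phaseIsom_apply, hu, hne a ha]
    have eb : phaseIsom u ϑ.1 b = ϑ.1 b := by simp [phaseIsom_apply, hu, hbc]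
    have ec : phaseIsom u ϑ.1 c = Complex.I * ϑ.1 c := by simp [phaseIsom_apply, hu]
    have e4 : ∀ z : ℂ, ‖z‖ ^ 4 = Complex.normSq z ^ 2 := fun z => by
      rw [← Complex.sq_norm]; ring
    simp only [hF, e, eb, ec, Complex.sq_norm, e4]
    simp only [Complex.normSq_apply, Complex.add_re, Complex.add_im, Complex.sub_re,
      Complex.sub_im, Complex.I_mul_re, Complex.I_mul_im]
    ring
  have h4 := congrArg (fun f : PureState n → ℝ => ∫ ϑ, f ϑ ∂haarState n) (funext h3)
  simp only at h4
  have hcs : Continuous fun ϑ : PureState n => ϑ.1 := continuous_subtype_val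
  have i1 : Integrable (fun ϑ : PureState n => F ϑ.1) (haarState n) :=
    integrable_of_continuous (hFc.comp hcs)
  have i2 : Integrable (fun ϑ : PureState n => F (phaseIsom u ϑ.1)) (haarState n) :=
    integrable_of_continuous (hFc.comp ((phaseIsom u).continuous.comp hcs))
  rw [integral_add i1 i2,
    integral_add (integrable_of_continuous (by fun_prop)) (integrable_of_continuous (by fun_prop)),
    h2, integral_const_mul, integral_const_mul, ← integral_swap_sq hb hc 4] at h4
  rw [h1]
  linarith

/-- Insert the factor `∑ b, |ϑ_b|² = 1`. Each of the `2 ^ n - |S|` labels outside `S` contributes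
one new moment, and each label in `S` contributes two by `integral_fourth_power`. -/
theorem sqMoment_insert {S : Finset (Bits n)} {c : Bits n} (hc : c ∉ S) :
    sqMoment S = (2 ^ n + S.card : ℝ) * sqMoment (insert c S) := by
  have hcs : Continuous fun ϑ : PureState n => ϑ.1 := continuous_subtype_val
  have h1 : sqMoment S = ∑ b, ∫ ϑ : PureState n, ‖ϑ.1 b‖ ^ 2 * ∏ a ∈ S, ‖ϑ.1 a‖ ^ 2
      ∂haarState n := by
    rw [← integral_finsetSum _ fun b _ => integrable_of_continuous (by fun_prop)]
    refine integral_congr_ae (Filter.Eventually.of_forall fun ϑ => ?_)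
    simp only [← Finset.sum_mul, sum_sq_norm, one_mul]
  have h2 : ∀ b ∉ S, ∫ ϑ : PureState n, ‖ϑ.1 b‖ ^ 2 * ∏ a ∈ S, ‖ϑ.1 a‖ ^ 2 ∂haarState n =
      sqMoment (insert c S) := by
    intro b hb
    rw [integral_swap_sq hb hc, sqMoment]
    simp only [Finset.prod_insert hc]
  have h3 : ∀ b ∈ S, ∫ ϑ : PureState n, ‖ϑ.1 b‖ ^ 2 * ∏ a ∈ S, ‖ϑ.1 a‖ ^ 2 ∂haarState n =
      2 * sqMoment (insert c S) := by
    intro b hb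
    have hbc : b ≠ c := fun h => hc (h ▸ hb)
    have := integral_fourth_power hbc (Finset.notMem_erase b S)
      (fun h => hc (Finset.mem_of_mem_erase h))
    rw [sqMoment]
    simp only [Finset.prod_insert hc, ← Finset.mul_prod_erase S _ hb]
    refine Eq.trans (integral_congr_ae (Filter.Eventually.of_forall fun ϑ => ?_)) (this.trans ?_)
    · simp only; ring
    · congr 1
      refine integral_congr_ae (Filter.Eventually.of_forall fun ϑ => ?_)
      simp only; ring
  rw [h1, ← Finset.sum_add_sum_compl S, Finset.sum_congr rfl h3,
    Finset.sum_congr rfl fun b hb => h2 b (Finset.mem_compl.1 hb), Finset.sum_const,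
    Finset.sum_const, Finset.card_compl, nsmul_eq_mul, nsmul_eq_mul,
    Nat.cast_sub (Finset.card_le_univ S)]
  have : (Fintype.card (Bits n) : ℝ) = 2 ^ n := by simp
  rw [this]
  ring

theorem sqMoment_eq (S : Finset (Bits n)) :
    sqMoment S = ((((2 ^ n : ℕ).ascFactorial S.card : ℕ) : ℝ))⁻¹ := by
  induction S using Finset.induction_on with
  | empty => simp [sqMoment]
  | insert c S hc ih =>
    have h := sqMoment_insert hc
    have hpos : (0 : ℝ) < 2 ^ n + S.card := by positivity
    rw [ih] at h
    rw [Finset.card_insert_of_notMem hc, Nat.ascFactorial_succ, Nat.cast_mul, mul_inv, h]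
    push_cast
    field_simp

end Haar

/-! ### Mixed moments: vanishing and values on injective tuples. -/

section Moments

open MeasureTheory

variable {n : ℕ} {κ : Type} [Fintype κ]

@[fun_prop]
theorem continuous_amplitude (b : Bits n) : Continuous fun ϑ : PureState n => ϑ.1 b :=
  (continuous_coord b).comp continuous_subtype_val

/-- The entries `E ∏_i ϑ_{x i} conj ϑ_{y i}` of the moments of the Haar distribution. -/
def mom (x y : κ → Bits n) : ℂ :=
  ∫ ϑ : PureState n, ∏ i, (ϑ.1 (x i) * star (ϑ.1 (y i))) ∂haarState n

/-- The diagonal entries `E ∏_i |ϑ_{x i}|²` of the moments of the Haar distribution. -/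
def weight (x : κ → Bits n) : ℝ :=
  ∫ ϑ : PureState n, ∏ i, ‖ϑ.1 (x i)‖ ^ 2 ∂haarState n

theorem mom_self (x : κ → Bits n) : mom x x = weight x := by
  rw [mom, weight, ← integral_complex_ofReal]
  congr 1
  funext ϑ
  rw [Complex.ofReal_prod]
  refine Finset.prod_congr rfl fun i _ => ?_
  rw [Complex.star_def, Complex.mul_conj, Complex.normSq_eq_norm_sq]

theorem weight_nonneg (x : κ → Bits n) : 0 ≤ weight x :=
  integral_nonneg fun _ => Finset.prod_nonneg fun _ _ => by positivity

theorem mom_comp_perm (x : κ → Bits n) (σ : Equiv.Perm κ) : mom x (x ∘ σ) = mom x x := by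
  rw [mom, mom]
  congr 1
  funext ϑ
  rw [Finset.prod_mul_distrib, Finset.prod_mul_distrib]
  congr 1
  exact Equiv.prod_comp σ fun i => star (ϑ.1 (x i))

theorem weight_of_injective {x : κ → Bits n} (hx : Function.Injective x) :
    weight x = (((2 ^ n : ℕ).ascFactorial (Fintype.card κ) : ℕ) : ℝ)⁻¹ := by
  classical
  have h := sqMoment_eq (Finset.univ.image x)
  rw [Finset.card_image_of_injective _ hx, Finset.card_univ] at h
  rw [← h, weight, sqMoment]
  congr 1
  funext ϑ
  rw [Finset.prod_image hx.injOn]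

variable [DecidableEq κ] in
theorem sum_weight : ∑ x : κ → Bits n, weight x = 1 := by
  simp only [weight]
  rw [← integral_finsetSum _ fun x _ => integrable_of_continuous (by fun_prop)]
  have : ∀ ϑ : PureState n, ∑ x : κ → Bits n, ∏ i, ‖ϑ.1 (x i)‖ ^ 2 = 1 := by
    intro ϑ
    have h := Finset.prod_univ_sum (fun _ : κ => (Finset.univ : Finset (Bits n)))
      fun _ b => ‖ϑ.1 b‖ ^ 2
    rw [Fintype.piFinset_univ] at h
    rw [← h]
    simp [sum_sq_norm]
  simp [this]

omit [Fintype κ] in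
theorem exists_perm_of_forall_exists [Finite κ] {β : Type} {x y : κ → β}
    (hy : Function.Injective y) (h : ∀ i, ∃ j, y i = x j) :
    ∃ σ : Equiv.Perm κ, y = x ∘ σ := by
  choose f hf using h
  have hinj : Function.Injective f := fun i j hij => hy (by rw [hf, hf, hij])
  exact ⟨Equiv.ofBijective f (Finite.injective_iff_bijective.1 hinj), funext hf⟩

/-- The source of all vanishing: if the phase product on the right is not 1, the moment is 0. -/
theorem mom_phase (u : Bits n → Circle) (x y : κ → Bits n) :
    mom x y = (∏ i, ((u (x i) : ℂ) * star (u (y i) : ℂ))) * mom x y := by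
  conv_lhs => rw [mom, ← integral_isom (phaseIsom u)
    (f := fun v => ∏ i, (v (x i) * star (v (y i)))) (by fun_prop)]
  rw [mom, ← integral_const_mul]
  congr 1
  funext ϑ
  rw [← Finset.prod_mul_distrib]
  refine Finset.prod_congr rfl fun i _ => ?_
  rw [phaseIsom_apply, phaseIsom_apply, star_mul']
  ring

theorem card_filter_eq_of_mom_ne_zero {x y : κ → Bits n} (h : mom x y ≠ 0) (b : Bits n) :
    (Finset.univ.filter fun i => x i = b).card = (Finset.univ.filter fun i => y i = b).card := by
  -- Both counts are below `N`, so multiplying the single coordinate `b` by a primitive `N`-th root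
  -- of unity distinguishes them.
  set N := Fintype.card κ + 1 with hN
  have hN0 : N ≠ 0 := Nat.succ_ne_zero _
  have hζ := Complex.isPrimitiveRoot_exp N hN0
  set ζ := Complex.exp (2 * Real.pi * Complex.I / N) with hζd
  have hζn : ‖ζ‖ = 1 := hζ.norm'_eq_one hN0
  set z : Circle := ⟨ζ, by simp [Submonoid.unitSphere, hζn]⟩ with hz
  have hp := mom_phase (fun a => if a = b then z else 1) x y
  have h1 := mul_right_cancel₀ h ((one_mul _).trans hp)
  have hx : ∀ w : κ → Bits n, ∏ i, (((if w i = b then z else 1 : Circle) : Circle) : ℂ) =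
      ζ ^ (Finset.univ.filter fun i => w i = b).card := by
    intro w
    rw [← Finset.prod_const, Finset.prod_filter]
    refine Finset.prod_congr rfl fun i _ => ?_
    split_ifs <;> simp [hz]
  rw [Finset.prod_mul_distrib, hx, ← star_prod, hx, star_pow] at h1
  have h2 : star ζ * ζ = 1 := by
    rw [mul_comm, Complex.star_def, Complex.mul_conj, Complex.normSq_eq_norm_sq, hζn]; simp
  have hle : ∀ w : κ → Bits n, (Finset.univ.filter fun i => w i = b).card < N := fun w =>
    Nat.lt_succ_of_le (Finset.card_le_univ _)
  refine hζ.pow_inj (hle x) (hle y) ?_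
  have h3 := congrArg (· * ζ ^ (Finset.univ.filter fun i => y i = b).card) h1
  simp only [one_mul] at h3
  rw [mul_assoc, ← mul_pow, h2, one_pow, mul_one] at h3
  exact h3.symm

/-- Equal multiplicities transfer injectivity from `x` to `y` and give both the same set of entries.
-/
theorem exists_perm_of_mom_ne_zero {x y : κ → Bits n} (hx : Function.Injective x)
    (h : mom x y ≠ 0) : ∃ σ : Equiv.Perm κ, y = x ∘ σ := by
  have hc := card_filter_eq_of_mom_ne_zero h
  refine exists_perm_of_forall_exists (fun i j hij => ?_) fun i => ?_
  · have h1 : (Finset.univ.filter fun k => x k = y j).card ≤ 1 := by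
      refine Finset.card_le_one.2 fun a ha c hc => hx ?_
      rw [(Finset.mem_filter.1 ha).2, (Finset.mem_filter.1 hc).2]
    rw [hc] at h1
    exact Finset.card_le_one.1 h1 i (by simp [hij]) j (by simp)
  · have h1 : 0 < (Finset.univ.filter fun k => y k = y i).card :=
      Finset.card_pos.2 ⟨i, by simp⟩
    rw [← hc] at h1
    obtain ⟨j, hj⟩ := Finset.card_pos.1 h1
    exact ⟨j, (Finset.mem_filter.1 hj).2.symm⟩

theorem mom_of_perm {x : κ → Bits n} (hx : Function.Injective x) (σ : Equiv.Perm κ) :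
    mom x (x ∘ σ) = ((((2 ^ n : ℕ).ascFactorial (Fintype.card κ) : ℕ) : ℝ)⁻¹ : ℝ) := by
  rw [mom_comp_perm, mom_self, weight_of_injective hx]

/-- Averages of rank one operators are positive. -/
theorem posSemidef_of_integral {Ω ι : Type} [Fintype ι] [MeasurableSpace Ω] {μ : Measure Ω}
    {f : Ω → ι → ℂ} (hf : ∀ x y, Integrable (fun ω => f ω x * star (f ω y)) μ) :
    (Matrix.of fun x y => ∫ ω, f ω x * star (f ω y) ∂μ : Op ι).PosSemidef := by
  refine Matrix.PosSemidef.of_dotProduct_mulVec_nonneg ?_ fun v => ?_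
  · ext x y
    rw [Matrix.conjTranspose_apply, Matrix.of_apply, Matrix.of_apply]
    refine (integral_conj (f := fun ω => f ω y * star (f ω x))).symm.trans ?_
    congr 1
    funext ω
    simp [mul_comm]
  -- The quadratic form at `v` is the average of the squared modulus of an inner product.
  · have h : star v ⬝ᵥ ((Matrix.of fun x y => ∫ ω, f ω x * star (f ω y) ∂μ : Op ι) *ᵥ v) =
        ∫ ω, ((‖∑ x, star (v x) * f ω x‖ ^ 2 : ℝ) : ℂ) ∂μ := by
      have e : ∀ ω, ((‖∑ x, star (v x) * f ω x‖ ^ 2 : ℝ) : ℂ) =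
          ∑ x, ∑ y, star (v x) * (f ω x * star (f ω y)) * v y := by
        intro ω
        rw [← Complex.normSq_eq_norm_sq, ← Complex.mul_conj, map_sum, Finset.sum_mul_sum]
        refine Finset.sum_congr rfl fun x _ => Finset.sum_congr rfl fun y _ => ?_
        simp only [map_mul, Complex.star_def, Complex.conj_conj]
        ring
      simp only [e]
      rw [integral_finsetSum _ fun x _ => integrable_finsetSum _ fun y _ =>
        ((hf x y).const_mul _).mul_const _]
      refine Finset.sum_congr rfl fun x _ => ?_
      rw [integral_finsetSum _ fun y _ => ((hf x y).const_mul _).mul_const _, Matrix.mulVec,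
        dotProduct, Finset.mul_sum]
      refine Finset.sum_congr rfl fun y _ => ?_
      rw [integral_mul_const, integral_const_mul, Matrix.of_apply, mul_assoc]
      rfl
    rw [h, integral_complex_ofReal]
    exact Complex.zero_le_real.2 (integral_nonneg fun _ => by positivity)

end Moments

/-! ### Matrix entries of the real and the ideal states -/

section Entries

open MeasureTheory

variable {lam n ℓ t p : ℕ}

/-- The average over the keys of the phases of two tuples. -/
def mask (lam : ℕ) (x y : Fin ℓ → Bits n) : ℂ :=
  𝔼 k : Bits lam, ∏ j, (((phaseSign n k (x j) * phaseSign n k (y j) : ℤˣ) : ℤ) : ℂ)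

/-- All positions of a tuple in one index type. -/
def flat : ((Fin p → Fin ℓ → Bits n) × (Fin t → Bits n)) ≃ (Fin p × Fin ℓ ⊕ Fin t → Bits n) :=
  ((Equiv.curry (Fin p) (Fin ℓ) (Bits n)).symm.prodCongr (Equiv.refl _)).trans
    (Equiv.sumArrowEquivProdArrow _ _ _).symm

@[simp]
theorem flat_inl (x : (Fin p → Fin ℓ → Bits n) × (Fin t → Bits n)) (i : Fin p) (j : Fin ℓ) :
    flat x (Sum.inl (i, j)) = x.1 i j := rfl

@[simp]
theorem flat_inr (x : (Fin p → Fin ℓ → Bits n) × (Fin t → Bits n)) (j : Fin t) :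
    flat x (Sum.inr j) = x.2 j := rfl

theorem expect_prod_pi {α : Type} [Fintype α] (g : Fin p → α → ℂ) :
    (𝔼 k : Fin p → α, ∏ i, g i (k i)) = ∏ i, 𝔼 a, g i a := by
  classical
  simp only [Fintype.expect_eq_sum_div_card]
  have h := Finset.prod_univ_sum (fun _ : Fin p => (Finset.univ : Finset α)) g
  rw [Fintype.piFinset_univ] at h
  rw [Finset.prod_div_distrib, h]
  simp

/-- The signs do not depend on `ϑ` and leave the integral. What remains treats all copies alike,
hence `flat`; independence of the keys splits their average by block. -/
theorem realStateMulti_apply (x y : (Fin p → Fin ℓ → Bits n) × (Fin t → Bits n)) :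
    realStateMulti (phaseMap (lam := lam) n) ℓ t p x y =
      (∏ i, mask lam (x.1 i) (y.1 i)) * mom (flat x) (flat y) := by
  have h : ∀ k : Fin p → Bits lam, (∫ ϑ : PureState n,
      (tensorPi (fun i => tensorPow (phaseMap n (k i) ϑ.density) ℓ) ⊗ₖ
        tensorPow ϑ.density t) x y ∂haarState n) =
      (∏ i, ∏ j, (((phaseSign n (k i) (x.1 i j) * phaseSign n (k i) (y.1 i j) : ℤˣ) : ℤ) : ℂ)) *
        mom (flat x) (flat y) := by
    intro k
    rw [mom, ← integral_const_mul]
    congr 1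
    funext ϑ
    rw [Matrix.kroneckerMap_apply, Fintype.prod_sum_type, Fintype.prod_prod_type, ← mul_assoc,
      ← Finset.prod_mul_distrib]
    congr 1
    · show (∏ i, ∏ j, phaseMap n (k i) ϑ.density (x.1 i j) (y.1 i j)) = _
      refine Finset.prod_congr rfl fun i _ => ?_
      rw [← Finset.prod_mul_distrib]
      refine Finset.prod_congr rfl fun j _ => ?_
      simp only [phaseMap_apply, PureState.density, Matrix.of_apply, flat_inl, Units.val_mul,
        Int.cast_mul]
      ring
  rw [realStateMulti, Matrix.of_apply]
  simp only [h]
  rw [← Finset.expect_mul]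
  congr 1
  exact expect_prod_pi fun i k =>
    ∏ j, (((phaseSign n k (x.1 i j) * phaseSign n k (y.1 i j) : ℤˣ) : ℤ) : ℂ)

theorem realState_apply (x y : (Fin ℓ → Bits n) × (Fin t → Bits n)) :
    realState (phaseMap (lam := lam) n) ℓ t x y =
      realStateMulti (phaseMap (lam := lam) n) ℓ t 1 (fun _ => x.1, x.2) (fun _ => y.1, y.2) := by
  rw [realState, realStateMulti, Matrix.of_apply, Matrix.of_apply]
  refine (Fintype.expect_equiv (Equiv.funUnique (Fin 1) (Bits lam)) _ _ fun k => ?_).symm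
  congr 1
  funext ϑ
  simp [Matrix.kroneckerMap_apply, tensorPi]

theorem idealStateMulti_apply (x y : (Fin p → Fin ℓ → Bits n) × (Fin t → Bits n)) :
    idealStateMulti n ℓ t p x y = (∏ i, mom (x.1 i) (y.1 i)) * mom x.2 y.2 := by
  rw [idealStateMulti, Matrix.of_apply]
  simp only [Matrix.kroneckerMap_apply]
  rw [integral_prod_mul (fun ω : Fin p → PureState n =>
    tensorPi (fun i => tensorPow (ω i).density ℓ) x.1 y.1)
    fun ω : PureState n => tensorPow ω.density t x.2 y.2]
  congr 1
  exact integral_fintype_prod_eq_prod (μ := fun _ : Fin p => haarState n)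
    (fun i (ω : PureState n) => tensorPow ω.density ℓ (x.1 i) (y.1 i))

theorem idealState_apply (x y : (Fin ℓ → Bits n) × (Fin t → Bits n)) :
    idealState n ℓ t x y =
      idealStateMulti n ℓ t 1 (fun _ => x.1, x.2) (fun _ => y.1, y.2) := by
  rw [idealStateMulti_apply, idealState, Matrix.of_apply]
  simp only [Matrix.kroneckerMap_apply]
  rw [integral_prod_mul (fun ω : PureState n => tensorPow ω.density ℓ x.1 y.1)
    fun ω : PureState n => tensorPow ω.density t x.2 y.2, Fin.prod_univ_one]
  rfl

theorem realStateMulti_posSemidef :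
    (realStateMulti (phaseMap (lam := lam) n) ℓ t p).PosSemidef := by
  set f : (Fin p → Bits lam) → PureState n →
      ((Fin p → Fin ℓ → Bits n) × (Fin t → Bits n)) → ℂ := fun k ϑ x =>
    (∏ i, ∏ j, (((phaseSign n (k i) (x.1 i j) : ℤˣ) : ℤ) : ℂ) * ϑ.1 (x.1 i j)) *
      ∏ j, ϑ.1 (x.2 j) with hf
  have h : realStateMulti (phaseMap (lam := lam) n) ℓ t p =
      ((Fintype.card (Fin p → Bits lam) : ℝ)⁻¹ : ℝ) • ∑ k : Fin p → Bits lam,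
        (Matrix.of fun x y => ∫ ϑ : PureState n, f k ϑ x * star (f k ϑ y) ∂haarState n :
          Op ((Fin p → Fin ℓ → Bits n) × (Fin t → Bits n))) := by
    ext x y
    rw [realStateMulti, Matrix.of_apply, Fintype.expect_eq_sum_div_card, Matrix.smul_apply,
      Matrix.sum_apply, Complex.real_smul, div_eq_inv_mul]
    congr 1
    · push_cast; rfl
    · refine Finset.sum_congr rfl fun k _ => ?_
      rw [Matrix.of_apply]
      congr 1
      funext ϑ
      rw [Matrix.kroneckerMap_apply, hf]
      simp only [tensorPi, tensorPow, Matrix.of_apply, phaseMap_apply, PureState.density,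
        star_mul', star_prod, star_intCast, Finset.prod_mul_distrib]
      ring
  rw [h]
  refine Matrix.PosSemidef.smul (Matrix.posSemidef_sum _ fun k _ => ?_) (by positivity)
  refine posSemidef_of_integral fun x y => integrable_of_continuous ?_
  fun_prop

theorem idealStateMulti_posSemidef : (idealStateMulti n ℓ t p).PosSemidef := by
  set f : (Fin p → PureState n) × PureState n →
      ((Fin p → Fin ℓ → Bits n) × (Fin t → Bits n)) → ℂ := fun ω x =>
    (∏ i, ∏ j, (ω.1 i).1 (x.1 i j)) * ∏ j, ω.2.1 (x.2 j) with hf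
  have h : idealStateMulti n ℓ t p = Matrix.of fun x y => ∫ ω : (Fin p → PureState n) × PureState n,
      f ω x * star (f ω y)
        ∂((Measure.pi fun _ : Fin p => haarState n).prod (haarState n)) := by
    ext x y
    rw [idealStateMulti, Matrix.of_apply, Matrix.of_apply]
    congr 1
    funext ω
    rw [Matrix.kroneckerMap_apply, hf]
    simp only [tensorPi, tensorPow, Matrix.of_apply, PureState.density,
      star_mul', star_prod, Finset.prod_mul_distrib]
    ring
  rw [h]
  refine posSemidef_of_integral fun x y => integrable_of_continuous ?_
  have h1 : ∀ (i : Fin p) (b : Bits n), Continuous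
      fun ω : (Fin p → PureState n) × PureState n => (ω.1 i).1 b := fun i b =>
    (continuous_amplitude b).comp ((continuous_apply i).comp continuous_fst)
  have h2 : ∀ b : Bits n, Continuous
      fun ω : (Fin p → PureState n) × PureState n => ω.2.1 b := fun b =>
    (continuous_amplitude b).comp continuous_snd
  fun_prop

/-- The product of the signs of the `j`-th bits. -/
def paritySign (x : Fin ℓ → Bits n) (j : Fin n) : ℤˣ := ∏ i, bitSign (x i j)

/-- The total sign of a tuple is symmetric in its entries, so it occurs squared. -/
theorem mask_perm (x : Fin ℓ → Bits n) (σ : Equiv.Perm (Fin ℓ)) : mask lam x (x ∘ σ) = 1 := by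
  have : ∀ k : Bits lam, ∏ j, (((phaseSign n k (x j) * phaseSign n k ((x ∘ σ) j) : ℤˣ) : ℤ) : ℂ) =
      1 := by
    intro k
    rw [← Int.cast_prod, ← Units.coe_prod, Finset.prod_mul_distrib]
    rw [show (∏ j, phaseSign n k ((x ∘ σ) j)) = ∏ j, phaseSign n k (x j) from
      Equiv.prod_comp σ fun j => phaseSign n k (x j), Int.units_mul_self]
    simp
  rw [mask]
  simp only [this]
  exact Fintype.expect_const 1

theorem mask_self (x : Fin ℓ → Bits n) : mask lam x x = 1 := mask_perm x (Equiv.refl _)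

/-- The key average factors over key bits. Bit `j` contributes the mean of `1`, for a zero bit, and
of the product of the two parities, here `-1`. -/
theorem mask_eq_zero (hn : lam ≤ n) {x y : Fin ℓ → Bits n} (j : Fin lam)
    (hj : paritySign x (j.castLE hn) ≠ paritySign y (j.castLE hn)) : mask lam x y = 0 := by
  have h1 : ∀ k : Bits lam, ∏ i, (((phaseSign n k (x i) * phaseSign n k (y i) : ℤˣ) : ℤ) : ℂ) =
      ∏ j : Fin lam, ∏ i, (((bitSign (k j && x i (j.castLE hn)) *
        bitSign (k j && y i (j.castLE hn)) : ℤˣ) : ℤ) : ℂ) := by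
    intro k
    rw [Finset.prod_comm]
    refine Finset.prod_congr rfl fun i _ => ?_
    rw [phaseSign_eq hn, phaseSign_eq hn, ← Finset.prod_mul_distrib, Units.coe_prod,
      Int.cast_prod]
  rw [mask]
  simp only [h1]
  rw [expect_prod_pi fun (j : Fin lam) (b : Bool) => ∏ i, (((bitSign (b && x i (j.castLE hn)) *
        bitSign (b && y i (j.castLE hn)) : ℤˣ) : ℤ) : ℂ)]
  refine Finset.prod_eq_zero (Finset.mem_univ j) ?_
  have h2 : paritySign x (j.castLE hn) * paritySign y (j.castLE hn) = -1 := by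
    rcases Int.units_eq_one_or (paritySign x (j.castLE hn)) with h | h <;>
    rcases Int.units_eq_one_or (paritySign y (j.castLE hn)) with h' | h' <;>
    simp_all
  rw [paritySign, paritySign, ← Finset.prod_mul_distrib] at h2
  rw [Fintype.expect_eq_sum_div_card, Fintype.sum_bool]
  simp only [Bool.true_and, Bool.false_and]
  rw [← Int.cast_prod, ← Units.coe_prod, h2]
  simp [bitSign]

end Entries

/-! ### Collision-free tuples -/

section Good

variable {lam n ℓ t p : ℕ}

/-- The tuples with distinct entries in which distinct sub-collections of `ℓ` entries have distinct
parities on the first `lam` bits. -/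
def Good {κ : Type} (lam ℓ : ℕ) (x : κ → Bits n) : Prop :=
  Function.Injective x ∧ ∀ A B : Finset κ, A.card = ℓ → B.card = ℓ →
    (∀ j : Fin n, j.1 < lam → ∏ a ∈ A, bitSign (x a j) = ∏ b ∈ B, bitSign (x b j)) → A = B

theorem Good.comp_perm {κ : Type} {x : κ → Bits n} (h : Good lam ℓ x) (σ : Equiv.Perm κ) :
    Good lam ℓ (x ∘ σ) := by
  refine ⟨h.1.comp σ.injective, fun A B hA hB hAB => ?_⟩
  refine Finset.map_injective σ.toEmbedding (h.2 _ _ (by simpa) (by simpa) fun j hj => ?_)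
  simpa [Finset.prod_map] using hAB j hj

/-- The positions of the `i`-th block. -/
def block (t : ℕ) (ℓ : ℕ) (i : Fin p) : Finset (Fin p × Fin ℓ ⊕ Fin t) :=
  Finset.univ.map ⟨fun j : Fin ℓ => Sum.inl (i, j), fun a b h => by simpa using h⟩

theorem mem_block {i : Fin p} {a : Fin p × Fin ℓ ⊕ Fin t} :
    a ∈ block t ℓ i ↔ ∃ j, a = Sum.inl (i, j) := by
  simp only [block, Finset.mem_map, Finset.mem_univ, true_and]
  exact exists_congr fun j => eq_comm

theorem card_block (i : Fin p) : (block t ℓ i).card = ℓ := by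
  simp [block]

theorem prod_block {M : Type} [CommMonoid M] (i : Fin p) (f : Fin p × Fin ℓ ⊕ Fin t → M) :
    ∏ a ∈ block t ℓ i, f a = ∏ j, f (Sum.inl (i, j)) := by
  rw [block, Finset.prod_map]
  rfl

theorem flat_comp_perm {x y : (Fin p → Fin ℓ → Bits n) × (Fin t → Bits n)}
    {σ : Fin p → Equiv.Perm (Fin ℓ)} {τ : Equiv.Perm (Fin t)} (hσ : ∀ i, y.1 i = x.1 i ∘ σ i)
    (hτ : y.2 = x.2 ∘ τ) :
    flat y = flat x ∘ (Equiv.sumCongr (Equiv.prodCongrRight σ) τ) := by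
  funext a
  rcases a with ⟨i, j⟩ | j
  · simp [hσ]
  · simp [hτ]

/-- The moment provides one permutation `σ` of all positions. A nonzero mask says that a block and
its image under `σ` have the same XOR, and goodness makes them the same set. So `σ` preserves each
block, and therefore also the `t` remaining positions. -/
theorem exists_block_perms (hn : lam ≤ n) {x y : (Fin p → Fin ℓ → Bits n) × (Fin t → Bits n)}
    (hx : Good lam ℓ (flat x)) (h : realStateMulti (phaseMap (lam := lam) n) ℓ t p x y ≠ 0) :
    (∀ i, ∃ σ : Equiv.Perm (Fin ℓ), y.1 i = x.1 i ∘ σ) ∧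
      ∃ τ : Equiv.Perm (Fin t), y.2 = x.2 ∘ τ := by
  classical
  rw [realStateMulti_apply] at h
  obtain ⟨hmask, hmom⟩ := mul_ne_zero_iff.1 h
  obtain ⟨σ, hσ⟩ := exists_perm_of_mom_ne_zero hx.1 hmom
  have hy : Function.Injective (flat y) := hσ ▸ hx.1.comp σ.injective
  have hblock : ∀ i, (block t ℓ i).map σ.toEmbedding = block t ℓ i := by
    intro i
    refine hx.2 _ _ (by simp [card_block]) (card_block i) fun j hj => ?_
    rw [Finset.prod_map, prod_block, prod_block]
    have hm := (Finset.prod_ne_zero_iff.1 hmask) i (Finset.mem_univ i)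
    by_contra hne
    refine hm (mask_eq_zero hn ⟨j, hj⟩ fun he => hne ?_)
    have hyσ : ∀ a, flat x (σ a) = flat y a := fun a => (congrFun hσ a).symm
    simp only [Equiv.coe_toEmbedding, hyσ, flat_inl]
    exact he.symm
  constructor
  · intro i
    refine exists_perm_of_forall_exists (fun a b hab => ?_) fun j => ?_
    · have := hy (a₁ := Sum.inl (i, a)) (a₂ := Sum.inl (i, b)) hab
      simpa using this
    · have h1 : σ (Sum.inl (i, j)) ∈ block t ℓ i := by
        rw [← hblock i]
        exact Finset.mem_map_of_mem σ.toEmbedding (mem_block.2 ⟨j, rfl⟩)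
      obtain ⟨j', hj'⟩ := mem_block.1 h1
      refine ⟨j', ?_⟩
      rw [← flat_inl y, hσ, Function.comp_apply, hj', flat_inl]
  · refine exists_perm_of_forall_exists (fun a b hab => ?_) fun j => ?_
    · have := hy (a₁ := Sum.inr a) (a₂ := Sum.inr b) hab
      simpa using this
    · rcases h1 : σ (Sum.inr j) with ⟨i, j'⟩ | j'
      · have h2 : σ (Sum.inr j) ∈ (block t ℓ i).map σ.toEmbedding := by
          rw [hblock i, h1]; exact mem_block.2 ⟨j', rfl⟩
        obtain ⟨a, ha, hσa⟩ := Finset.mem_map.1 h2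
        obtain ⟨j'', rfl⟩ := mem_block.1 ha
        simp at hσa
      · refine ⟨j', ?_⟩
        rw [← flat_inr y, hσ, Function.comp_apply, h1, flat_inr]

theorem exists_perms_of_ideal_ne_zero {x y : (Fin p → Fin ℓ → Bits n) × (Fin t → Bits n)}
    (hx : Function.Injective (flat x)) (h : idealStateMulti n ℓ t p x y ≠ 0) :
    (∀ i, ∃ σ : Equiv.Perm (Fin ℓ), y.1 i = x.1 i ∘ σ) ∧
      ∃ τ : Equiv.Perm (Fin t), y.2 = x.2 ∘ τ := by
  rw [idealStateMulti_apply] at h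
  obtain ⟨h1, h2⟩ := mul_ne_zero_iff.1 h
  refine ⟨fun i => exists_perm_of_mom_ne_zero (fun a b hab => ?_)
    (Finset.prod_ne_zero_iff.1 h1 i (Finset.mem_univ i)),
    exists_perm_of_mom_ne_zero (fun a b hab => ?_) h2⟩
  · have := hx (a₁ := Sum.inl (i, a)) (a₂ := Sum.inl (i, b)) hab
    simpa using this
  · have := hx (a₁ := Sum.inr a) (a₂ := Sum.inr b) hab
    simpa using this

/-- The ratio of the nonzero entries of the real and the ideal states on good tuples. -/
def entryRatio (n ℓ t p : ℕ) : ℝ :=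
  (((2 ^ n : ℕ).ascFactorial ℓ : ℕ) : ℝ) ^ p * (((2 ^ n : ℕ).ascFactorial t : ℕ) : ℝ) /
    (((2 ^ n : ℕ).ascFactorial (p * ℓ + t) : ℕ) : ℝ)

theorem ascFactorial_pos' (n m : ℕ) : 0 < (2 ^ n : ℕ).ascFactorial m := by
  obtain ⟨d, hd⟩ := Nat.exists_eq_succ_of_ne_zero (pow_ne_zero n (two_ne_zero (α := ℕ)))
  rw [hd]
  exact Nat.ascFactorial_pos _ _

theorem ascFactorial_mul_le (d a b : ℕ) :
    d.ascFactorial a * d.ascFactorial b ≤ d.ascFactorial (a + b) := by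
  induction b with
  | zero => simp
  | succ b ih =>
    rw [← add_assoc, Nat.ascFactorial_succ, Nat.ascFactorial_succ, mul_left_comm]
    exact Nat.mul_le_mul (by omega) ih

/-- Rising factorials satisfy `d^(a) * d^(b) ≤ d^(a + b)`, because the later factors are larger. -/
theorem entryRatio_le_one (n ℓ t p : ℕ) : entryRatio n ℓ t p ≤ 1 := by
  refine div_le_one_of_le₀ ?_ (by positivity)
  norm_cast
  induction p with
  | zero => simp
  | succ p ih =>
    rw [pow_succ', mul_assoc, show (p + 1) * ℓ + t = ℓ + (p * ℓ + t) by ring]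
    exact (Nat.mul_le_mul_left _ ih).trans (ascFactorial_mul_le _ _ _)

theorem realStateMulti_eq_ratio_mul (hn : lam ≤ n)
    {x y : (Fin p → Fin ℓ → Bits n) × (Fin t → Bits n)} (hx : Good lam ℓ (flat x)) :
    realStateMulti (phaseMap (lam := lam) n) ℓ t p x y =
      entryRatio n ℓ t p * idealStateMulti n ℓ t p x y := by
  by_cases hperm : (∀ i, ∃ σ : Equiv.Perm (Fin ℓ), y.1 i = x.1 i ∘ σ) ∧
      ∃ τ : Equiv.Perm (Fin t), y.2 = x.2 ∘ τ
  · obtain ⟨h1, τ, hτ⟩ := hperm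
    choose σ hσ using h1
    have hx1 : ∀ i, Function.Injective (x.1 i) := fun i a b hab => by
      have := hx.1 (a₁ := Sum.inl (i, a)) (a₂ := Sum.inl (i, b)) hab
      simpa using this
    have hx2 : Function.Injective x.2 := fun a b hab => by
      have := hx.1 (a₁ := Sum.inr a) (a₂ := Sum.inr b) hab
      simpa using this
    rw [realStateMulti_apply, idealStateMulti_apply, flat_comp_perm hσ hτ, mom_of_perm hx.1]
    simp only [hσ, hτ, mask_perm, mom_of_perm (hx1 _), mom_of_perm hx2, Finset.prod_const_one,
      Finset.prod_const, Finset.card_univ, Fintype.card_fin, Fintype.card_sum, Fintype.card_prod,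
      one_mul]
    rw [entryRatio]
    have p1 : (0 : ℝ) < (((2 ^ n : ℕ).ascFactorial ℓ : ℕ) : ℝ) := by
      exact_mod_cast ascFactorial_pos' n ℓ
    have p2 : (0 : ℝ) < (((2 ^ n : ℕ).ascFactorial t : ℕ) : ℝ) := by
      exact_mod_cast ascFactorial_pos' n t
    rw [← Complex.ofReal_pow, ← Complex.ofReal_mul, ← Complex.ofReal_mul]
    congr 1
    rw [inv_pow]
    field_simp
  · have h1 : realStateMulti (phaseMap (lam := lam) n) ℓ t p x y = 0 := by
      by_contra h
      exact hperm (exists_block_perms hn hx h)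
    have h2 : idealStateMulti n ℓ t p x y = 0 := by
      by_contra h
      exact hperm (exists_perms_of_ideal_ne_zero hx.1 h)
    rw [h1, h2, mul_zero]

theorem idealStateMulti_eq_zero {x y : (Fin p → Fin ℓ → Bits n) × (Fin t → Bits n)}
    (hx : Good lam ℓ (flat x)) (hy : ¬ Good lam ℓ (flat y)) : idealStateMulti n ℓ t p x y = 0 := by
  by_contra h
  obtain ⟨h1, τ, hτ⟩ := exists_perms_of_ideal_ne_zero hx.1 h
  choose σ hσ using h1
  exact hy (flat_comp_perm hσ hτ ▸ hx.comp_perm _)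

theorem realStateMulti_diag (x : (Fin p → Fin ℓ → Bits n) × (Fin t → Bits n)) :
    realStateMulti (phaseMap (lam := lam) n) ℓ t p x x = weight (flat x) := by
  simp [realStateMulti_apply, mask_self, mom_self]

theorem trace_realStateMulti : (realStateMulti (phaseMap (lam := lam) n) ℓ t p).trace = 1 := by
  simp only [Matrix.trace, Matrix.diag_apply, realStateMulti_diag]
  rw [Equiv.sum_comp flat fun x => (weight x : ℂ), ← Complex.ofReal_sum, sum_weight,
    Complex.ofReal_one]

theorem trace_idealStateMulti : (idealStateMulti n ℓ t p).trace = 1 := by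
  simp only [Matrix.trace, Matrix.diag_apply, idealStateMulti_apply, mom_self]
  rw [Fintype.sum_prod_type]
  simp only [← Finset.mul_sum, ← Finset.sum_mul]
  have h := Finset.prod_univ_sum (fun _ : Fin p => (Finset.univ : Finset (Fin ℓ → Bits n)))
      fun _ x => (weight x : ℂ)
  rw [Fintype.piFinset_univ] at h
  rw [← h, ← Complex.ofReal_sum, ← Complex.ofReal_sum, sum_weight, sum_weight]
  simp

-- The diagonal of the real state is `weight` itself, since the mask of a tuple with itself is 1;
-- the error is thus a probability of bad tuples.
open Classical in
theorem diffBound_good (hn : lam ≤ n) :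
    DiffBound (realStateMulti (phaseMap (lam := lam) n) ℓ t p) (idealStateMulti n ℓ t p)
      (∑ x : Fin p × Fin ℓ ⊕ Fin t → Bits n with ¬ Good lam ℓ x, weight x) := by
  refine (DiffBound.of_proportional realStateMulti_posSemidef idealStateMulti_posSemidef
    (trace_realStateMulti.trans trace_idealStateMulti.symm) (fun x => Good lam ℓ (flat x))
    (entryRatio_le_one n ℓ t p) (fun x y hx => realStateMulti_eq_ratio_mul hn hx)
    fun x y hx hy => idealStateMulti_eq_zero hx hy).mono (le_of_eq ?_)
  simp only [realStateMulti_diag, Complex.ofReal_re]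
  rw [Finset.sum_filter, Finset.sum_filter]
  exact Equiv.sum_comp flat fun x => if ¬ Good lam ℓ x then weight x else 0

end Good

/-! ### The weight of the remaining tuples -/

section Weight

variable {lam n ℓ : ℕ} {κ : Type} [Fintype κ] [DecidableEq κ]

/-- The quotient is a product of factors `(d - i) / (d + i) ≥ 1 - 2 * i / d`, and the losses `2 * i`
sum to less than `m ^ 2` for positive `m`. -/
theorem descFactorial_div_ascFactorial_ge (d m : ℕ) (hd : 0 < d) :
    1 - (m : ℝ) ^ 2 / d ≤ (d.descFactorial m : ℝ) / (d.ascFactorial m : ℝ) := by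
  have hd' : (0 : ℝ) < d := by exact_mod_cast hd
  have hpos : ∀ m, (0 : ℝ) < (d.ascFactorial m : ℝ) := fun m => by
    obtain ⟨e, rfl⟩ := Nat.exists_eq_succ_of_ne_zero hd.ne'
    exact_mod_cast Nat.ascFactorial_pos _ _
  have hle : ∀ m, (d.descFactorial m : ℝ) / (d.ascFactorial m : ℝ) ≤ 1 := by
    intro m
    refine div_le_one_of_le₀ ?_ (hpos m).le
    norm_cast
    induction m with
    | zero => simp
    | succ m ih =>
      rw [Nat.descFactorial_succ, Nat.ascFactorial_succ]
      exact Nat.mul_le_mul (by omega) ih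
  induction m with
  | zero => simp
  | succ m ih =>
    set r := (d.descFactorial m : ℝ) / (d.ascFactorial m : ℝ) with hr
    have hr0 : 0 ≤ r := by positivity
    have e : (d.descFactorial (m + 1) : ℝ) / (d.ascFactorial (m + 1) : ℝ) =
        (((d - m : ℕ) : ℝ) / (d + m)) * r := by
      rw [Nat.descFactorial_succ, Nat.ascFactorial_succ, hr]
      push_cast
      rw [div_mul_div_comm]
    -- Truncated subtraction can only exceed the real difference, so `m > d` needs no separate case.
    have h1 : (d : ℝ) - m ≤ ((d - m : ℕ) : ℝ) := by
      rw [sub_le_iff_le_add]; exact_mod_cast (by omega : d ≤ d - m + m)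
    have h2 : 1 - 2 * (m : ℝ) / d ≤ ((d - m : ℕ) : ℝ) / (d + m) := by
      have h3 : 1 - 2 * (m : ℝ) / (d + m) ≤ ((d - m : ℕ) : ℝ) / (d + m) := by
        rw [sub_le_iff_le_add, ← add_div, le_div_iff₀ (by positivity)]
        linarith
      have h4 : 2 * (m : ℝ) / (d + m) ≤ 2 * m / d := by
        gcongr
        linarith [(Nat.cast_nonneg m : (0 : ℝ) ≤ m)]
      linarith
    rw [e]
    have h5 := mul_le_mul_of_nonneg_right h2 hr0
    have h6 : 2 * (m : ℝ) / d * r ≤ 2 * m / d := mul_le_of_le_one_right (by positivity) (hle m)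
    have h7 : ((m + 1 : ℕ) : ℝ) ^ 2 / d = (m : ℝ) ^ 2 / d + 2 * m / d + 1 / d := by
      push_cast; ring
    have h8 : 0 < 1 / (d : ℝ) := by positivity
    rw [h7]
    linarith

-- Injective tuples all have the same weight, so their total weight is the quotient of falling and
-- rising factorials; the rest is the complement.
open Classical in
theorem sum_weight_not_injective_le :
    ∑ x : κ → Bits n with ¬ Function.Injective x, weight x ≤ (Fintype.card κ : ℝ) ^ 2 / 2 ^ n := by
  have h1 := Finset.sum_filter_add_sum_filter_not Finset.univ
    (fun x : κ → Bits n => Function.Injective x) weight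
  rw [sum_weight, Finset.sum_congr rfl fun x hx =>
    weight_of_injective (Finset.mem_filter.1 hx).2, Finset.sum_const, nsmul_eq_mul] at h1
  have h2 : (Finset.univ.filter fun x : κ → Bits n => Function.Injective x).card =
      (2 ^ n).descFactorial (Fintype.card κ) := by
    rw [← Fintype.card_subtype, Fintype.card_congr (Equiv.subtypeInjectiveEquivEmbedding _ _),
      Fintype.card_embedding_eq]
    simp
  have h3 := descFactorial_div_ascFactorial_ge (2 ^ n) (Fintype.card κ) (by positivity)
  rw [h2, ← div_eq_mul_inv] at h1
  push_cast at h3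
  linarith

/-- The tuple obtained by flipping some of the first `lam` bits of the entry `a`. -/
def flipAt (a : κ) (x : κ → Bits n) (b : Bits lam) : κ → Bits n :=
  Function.update x a fun j => if h : j.1 < lam then xor (x a j) (b ⟨j, h⟩) else x a j

theorem bitSign_xor (a b : Bool) : bitSign (xor a b) = bitSign a * bitSign b := by
  cases a <;> cases b <;> simp [bitSign]

theorem bitSign_injective : Function.Injective bitSign := by
  intro a b
  cases a <;> cases b <;> simp [bitSign]

-- Pick a position `a` in `A` but not in `B`. Flipping bits of entry `a` moves the parity over `A`
-- by exactly the flipped pattern and fixes the parity over `B`. From a flipped colliding tuple the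
-- pattern is read off as the discrepancy of the parities, so the `2 ^ lam` flips of all colliding
-- tuples are distinct.
open Classical in
theorem card_parity_collision_mul_le (hn : lam ≤ n) {A B : Finset κ} (hcard : A.card = B.card)
    (hAB : A ≠ B) :
    (Finset.univ.filter fun x : κ → Bits n => ∀ j : Fin n, j.1 < lam →
      ∏ a ∈ A, bitSign (x a j) = ∏ b ∈ B, bitSign (x b j)).card * 2 ^ lam ≤
        (2 ^ n) ^ Fintype.card κ := by
  have hsub : ¬ A ⊆ B := fun h => hAB (Finset.eq_of_subset_of_card_le h hcard.ge)
  obtain ⟨a, haA, haB⟩ := Finset.not_subset.1 hsub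
  set P : (κ → Bits n) → Prop := fun x => ∀ j : Fin n, j.1 < lam →
      ∏ a ∈ A, bitSign (x a j) = ∏ b ∈ B, bitSign (x b j) with hP
  set F : {x : κ → Bits n // P x} × Bits lam → κ → Bits n := fun q => flipAt a q.1.1 q.2 with hF
  have hval : ∀ (x : κ → Bits n) (b : Bits lam) (j : Fin lam),
      flipAt a x b a (j.castLE hn) = xor (x a (j.castLE hn)) (b j) := by
    intro x b j
    rw [flipAt, Function.update_self, dif_pos (show (j.castLE hn).1 < lam from j.2)]
    rfl
  have hne : ∀ (x : κ → Bits n) (b : Bits lam) (c : κ), c ≠ a → flipAt a x b c = x c :=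
    fun x b c hc => Function.update_of_ne hc _ _
  have hb : ∀ (q : {x : κ → Bits n // P x} × Bits lam) (j : Fin lam), bitSign (q.2 j) =
      (∏ c ∈ A, bitSign (F q c (j.castLE hn))) * ∏ c ∈ B, bitSign (F q c (j.castLE hn)) := by
    intro q j
    have h1 : ∏ c ∈ A, bitSign (F q c (j.castLE hn)) =
        (∏ c ∈ A, bitSign (q.1.1 c (j.castLE hn))) * bitSign (q.2 j) := by
      rw [← Finset.mul_prod_erase A _ haA, ← Finset.mul_prod_erase A _ haA, hF]
      simp only [hval, bitSign_xor]
      rw [Finset.prod_congr rfl fun c hc => by rw [hne _ _ c (Finset.ne_of_mem_erase hc)],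
        mul_right_comm]
    have h2 : ∏ c ∈ B, bitSign (F q c (j.castLE hn)) =
        ∏ c ∈ B, bitSign (q.1.1 c (j.castLE hn)) :=
      Finset.prod_congr rfl fun c hc => by
        rw [hF]; simp only [hne _ _ c (fun h : c = a => haB (h ▸ hc))]
    rw [h1, h2, q.1.2 (j.castLE hn) j.2, mul_right_comm, Int.units_mul_self, one_mul]
  have hinj : Function.Injective F := by
    intro q r hqr
    have h2 : q.2 = r.2 := funext fun j => bitSign_injective (by rw [hb, hb, hqr])
    refine Prod.ext (Subtype.ext (funext fun c => ?_)) h2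
    have hc := congrFun hqr c
    by_cases hca : c = a
    · subst hca
      funext j
      by_cases hj : j.1 < lam
      · have h3 := congrFun hc j
        have e : j = (⟨j, hj⟩ : Fin lam).castLE hn := rfl
        rw [hF] at h3
        simp only at h3
        rw [e, hval, hval, h2] at h3
        exact Bool.xor_right_inj.1 ((Bool.xor_comm _ _).trans (h3.trans (Bool.xor_comm _ _)))
      · have h3 := congrFun hc j
        simpa [hF, flipAt, hj] using h3
    · rw [hF] at hc
      simpa only [hne _ _ c hca] using hc
  have h := Fintype.card_le_of_injective F hinj
  rw [Fintype.card_prod, Fintype.card_subtype] at h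
  simpa using h

-- Union bound over pairs of distinct `ℓ`-subsets. An injective tuple weighs at most its uniform
-- share `(2 ^ n) ^ (-m)`, because the rising factorial dominates the power, so counting suffices.
open Classical in
theorem sum_weight_injective_not_good_le (hn : lam ≤ n) :
    ∑ x : κ → Bits n with Function.Injective x ∧ ¬ Good lam ℓ x, weight x ≤
      (Fintype.card κ : ℝ) ^ (2 * ℓ) / 2 ^ lam := by
  set m := Fintype.card κ with hm
  set S : Finset (Finset κ × Finset κ) :=
    ((Finset.univ.powersetCard ℓ) ×ˢ (Finset.univ.powersetCard ℓ)).filter fun q => q.1 ≠ q.2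
  set C : Finset κ × Finset κ → Finset (κ → Bits n) := fun q =>
    Finset.univ.filter fun x : κ → Bits n => ∀ j : Fin n, j.1 < lam →
      ∏ a ∈ q.1, bitSign (x a j) = ∏ b ∈ q.2, bitSign (x b j) with hC
  have hsub : (Finset.univ.filter fun x : κ → Bits n => Function.Injective x ∧ ¬ Good lam ℓ x) ⊆
      S.biUnion C := by
    intro x hx
    obtain ⟨hxi, hxg⟩ := (Finset.mem_filter.1 hx).2
    have : ∃ A B : Finset κ, A.card = ℓ ∧ B.card = ℓ ∧ (∀ j : Fin n, j.1 < lam →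
        ∏ a ∈ A, bitSign (x a j) = ∏ b ∈ B, bitSign (x b j)) ∧ A ≠ B := by
      by_contra hcon
      push Not at hcon
      exact hxg ⟨hxi, hcon⟩
    obtain ⟨A, B, hA, hB, h1, h2⟩ := this
    refine Finset.mem_biUnion.2 ⟨(A, B), ?_, Finset.mem_filter.2 ⟨Finset.mem_univ _, h1⟩⟩
    simp [S, Finset.mem_powersetCard, hA, hB, h2]
  have hCcard : ∀ q ∈ S, ((C q).card : ℝ) ≤ ((2 : ℝ) ^ n) ^ m / 2 ^ lam := by
    intro q hq
    obtain ⟨h1, h2⟩ := Finset.mem_filter.1 hq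
    obtain ⟨h3, h4⟩ := Finset.mem_product.1 h1
    rw [le_div_iff₀ (by positivity)]
    exact_mod_cast card_parity_collision_mul_le hn
      ((Finset.mem_powersetCard.1 h3).2.trans (Finset.mem_powersetCard.1 h4).2.symm) h2
  have hS : (S.card : ℝ) ≤ (m : ℝ) ^ (2 * ℓ) := by
    have h1 : S.card ≤ m.choose ℓ * m.choose ℓ := by
      refine (Finset.card_filter_le _ _).trans (le_of_eq ?_)
      rw [Finset.card_product, Finset.card_powersetCard, Finset.card_univ]
    have h2 : m.choose ℓ * m.choose ℓ ≤ m ^ (2 * ℓ) := by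
      rw [two_mul, pow_add]
      exact Nat.mul_le_mul (Nat.choose_le_pow m ℓ) (Nat.choose_le_pow m ℓ)
    exact_mod_cast h1.trans h2
  have hw : ∀ x ∈ (Finset.univ.filter fun x : κ → Bits n =>
      Function.Injective x ∧ ¬ Good lam ℓ x), weight x ≤ (((2 : ℝ) ^ n) ^ m)⁻¹ := by
    intro x hx
    rw [weight_of_injective (Finset.mem_filter.1 hx).2.1]
    refine inv_anti₀ (by positivity) ?_
    have := Nat.pow_succ_le_ascFactorial (2 ^ n) m
    exact_mod_cast this
  refine (Finset.sum_le_card_nsmul _ _ _ hw).trans ?_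
  rw [nsmul_eq_mul]
  have hcard : ((Finset.univ.filter fun x : κ → Bits n =>
      Function.Injective x ∧ ¬ Good lam ℓ x).card : ℝ) ≤
        (m : ℝ) ^ (2 * ℓ) * (((2 : ℝ) ^ n) ^ m / 2 ^ lam) := by
    have h1 : ((Finset.univ.filter fun x : κ → Bits n =>
        Function.Injective x ∧ ¬ Good lam ℓ x).card : ℝ) ≤ ∑ q ∈ S, ((C q).card : ℝ) := by
      exact_mod_cast (Finset.card_le_card hsub).trans Finset.card_biUnion_le
    have h2 := Finset.sum_le_card_nsmul S _ _ hCcard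
    rw [nsmul_eq_mul] at h2
    exact h1.trans (h2.trans (by gcongr))
  refine (mul_le_mul_of_nonneg_right hcard (by positivity)).trans (le_of_eq ?_)
  field_simp

open Classical in
theorem sum_weight_not_good_le (hn : lam ≤ n) (hℓ : 0 < ℓ) :
    ∑ x : κ → Bits n with ¬ Good lam ℓ x, weight x ≤
      2 * ((Fintype.card κ : ℝ) ^ (2 * ℓ) / 2 ^ lam) := by
  have h1 : ∑ x : κ → Bits n with ¬ Good lam ℓ x, weight x ≤
      ∑ x : κ → Bits n with ¬ Function.Injective x, weight x +
        ∑ x : κ → Bits n with Function.Injective x ∧ ¬ Good lam ℓ x, weight x := by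
    rw [Finset.sum_filter, Finset.sum_filter, Finset.sum_filter, ← Finset.sum_add_distrib]
    refine Finset.sum_le_sum fun x _ => ?_
    have := weight_nonneg x
    by_cases hi : Function.Injective x <;> by_cases hg : Good lam ℓ x <;> simp [hi, hg, this]
  -- Positivity of `ℓ` enters here: for `ℓ = 0` the power on the right would be 1.
  have h2 : (Fintype.card κ : ℝ) ^ 2 / 2 ^ n ≤ (Fintype.card κ : ℝ) ^ (2 * ℓ) / 2 ^ lam := by
    have h3 : (Fintype.card κ : ℝ) ^ 2 ≤ (Fintype.card κ : ℝ) ^ (2 * ℓ) := by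
      have : (Fintype.card κ) ^ 2 ≤ (Fintype.card κ) ^ (2 * ℓ) := by
        rcases Nat.eq_zero_or_pos (Fintype.card κ) with h | h
        · simp [h]
        · exact Nat.pow_le_pow_right h (by omega)
      exact_mod_cast this
    have h4 : (2 : ℝ) ^ lam ≤ 2 ^ n := pow_le_pow_right₀ (by norm_num) hn
    gcongr
  have h5 := sum_weight_not_injective_le (n := n) (κ := κ)
  have h6 := sum_weight_injective_not_good_le (κ := κ) (ℓ := ℓ) hn
  linarith

end Weight

/-! ### The trace distance bounds -/

section Bounds

variable {lam n ℓ t p : ℕ}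

/-- With no keyed copies both sides are `t` copies of one Haar state. The case is separate because
the target bound is zero at `p = 0` and the collision estimate needs `0 < ℓ`. -/
theorem realStateMulti_eq_ideal (h : p * ℓ = 0) :
    realStateMulti (phaseMap (lam := lam) n) ℓ t p = idealStateMulti n ℓ t p := by
  have hp : ∀ i : Fin p, ℓ = 0 := fun i => by
    rcases mul_eq_zero.1 h with h | h
    · exact absurd i.2 (by omega)
    · exact h
  ext x y
  have h1 : ∀ i, mask lam (x.1 i) (y.1 i) = 1 := fun i => by
    have := hp i
    subst this
    rw [Subsingleton.elim (y.1 i) (x.1 i), mask_self]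
  have h2 : ∀ i, mom (x.1 i) (y.1 i) = 1 := fun i => by
    have := hp i
    subst this
    simp [mom]
  rw [realStateMulti_apply, idealStateMulti_apply]
  simp only [h1, h2, Finset.prod_const_one, one_mul]
  have : IsEmpty (Fin p × Fin ℓ) := ⟨fun q => by
    have := hp q.1
    have := q.2.2
    omega⟩
  rw [mom, mom]
  simp [Fintype.prod_sum_type]

theorem diffBound_multi (hn : lam ≤ n) :
    DiffBound (realStateMulti (phaseMap (lam := lam) n) ℓ t p) (idealStateMulti n ℓ t p)
      (2 * ((p : ℝ) * ((p : ℝ) * ℓ + t) ^ (2 * ℓ) / 2 ^ lam)) := by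
  classical
  rcases Nat.eq_zero_or_pos (p * ℓ) with h | h
  · rw [realStateMulti_eq_ideal h]
    exact (DiffBound.refl _).mono (by positivity)
  · refine ((diffBound_good hn).mono (sum_weight_not_good_le hn (Nat.pos_of_mul_pos_left h))).mono ?_
    -- The weight estimate has no factor `p`; it is inserted for free since `p ≥ 1`.
    have hp : (1 : ℝ) ≤ p := by exact_mod_cast Nat.pos_of_mul_pos_right h
    simp only [Fintype.card_sum, Fintype.card_prod, Fintype.card_fin]
    push_cast
    rw [mul_div_assoc]
    have h0 : (0 : ℝ) ≤ ((p : ℝ) * ℓ + t) ^ (2 * ℓ) / 2 ^ lam := by positivity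
    nlinarith

/-- A pair of tuples as a family of one tuple together with another tuple. -/
def singleBlock : ((Fin ℓ → Bits n) × (Fin t → Bits n)) ≃
    ((Fin 1 → Fin ℓ → Bits n) × (Fin t → Bits n)) :=
  (Equiv.funUnique (Fin 1) (Fin ℓ → Bits n)).symm.prodCongr (Equiv.refl _)

theorem diffBound_single (hn : lam ≤ n) :
    DiffBound (realState (phaseMap (lam := lam) n) ℓ t) (idealState n ℓ t)
      (2 * (((ℓ : ℝ) + t) ^ (2 * ℓ) / 2 ^ lam)) := by
  have h := (diffBound_multi (ℓ := ℓ) (t := t) (p := 1) hn).submatrix (singleBlock (n := n))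
  have h1 : (realStateMulti (phaseMap (lam := lam) n) ℓ t 1).submatrix singleBlock singleBlock =
      realState (phaseMap (lam := lam) n) ℓ t := by
    ext x y
    rw [realState_apply]
    rfl
  have h2 : (idealStateMulti n ℓ t 1).submatrix singleBlock singleBlock = idealState n ℓ t := by
    ext x y
    rw [idealState_apply]
    rfl
  rw [h1, h2] at h
  simpa using h

end Bounds

/-! ### Negligibility of the bound -/

section Asymptotic

open Filter Topology

theorem PolyBounded.eventually_le_pow {f : ℕ → ℕ} (hf : PolyBounded f) :
    ∃ a : ℕ, ∀ᶠ m : ℕ in atTop, f m ≤ m ^ a := by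
  obtain ⟨q, hq⟩ := hf
  refine ⟨q.natDegree + 1, ?_⟩
  filter_upwards [eventually_ge_atTop 1,
    -- Once `m` exceeds the sum of the coefficients, one extra power of `m` absorbs them all.
    eventually_ge_atTop (∑ i ∈ Finset.range (q.natDegree + 1), q.coeff i)] with m h1 h2
  refine (hq m).trans ?_
  rw [Polynomial.eval_eq_sum_range, pow_succ']
  refine le_trans ?_ (Nat.mul_le_mul_right _ h2)
  rw [Finset.sum_mul]
  refine Finset.sum_le_sum fun i hi => Nat.mul_le_mul_left _ (Nat.pow_le_pow_right h1 ?_)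
  exact Nat.lt_succ_iff.1 (Finset.mem_range.1 hi)

theorem tendsto_log_rpow_atTop {s : ℝ} (hs : 0 < s) :
    Tendsto (fun m : ℕ => Real.log (m : ℝ) ^ s) atTop atTop :=
  (tendsto_rpow_atTop hs).comp (Real.tendsto_log_atTop.comp tendsto_natCast_atTop_atTop)

/-- The spare factor `log ^ ε` tends to infinity and beats any constant; `ℓ * log lam = o(lam)` is
all that security uses about `ℓ`. -/
theorem eventually_mul_log_le {ε : ℝ} (hε : 0 < ε) {ℓ : ℕ → ℕ}
    (hℓ : (fun lam : ℕ => (ℓ lam : ℝ)) =O[atTop]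
      fun lam : ℕ => (lam : ℝ) / Real.log (lam : ℝ) ^ (1 + ε)) {δ : ℝ} (hδ : 0 < δ) :
    ∀ᶠ lam : ℕ in atTop, (ℓ lam : ℝ) * Real.log lam ≤ δ * lam := by
  obtain ⟨C, hC, hbound⟩ := hℓ.exists_pos
  have hlog : ∀ᶠ lam : ℕ in atTop, 1 ≤ Real.log (lam : ℝ) :=
    (Real.tendsto_log_atTop.comp tendsto_natCast_atTop_atTop).eventually_ge_atTop 1
  filter_upwards [hbound.bound, hlog, (tendsto_log_rpow_atTop hε).eventually_ge_atTop (C / δ)]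
    with lam h1 h2 h3
  have hL : 0 < Real.log (lam : ℝ) := by linarith
  have hLε : 0 < Real.log (lam : ℝ) ^ ε := Real.rpow_pos_of_pos hL ε
  rw [Real.norm_of_nonneg (by positivity), Real.norm_of_nonneg (by positivity),
    Real.rpow_add hL, Real.rpow_one] at h1
  calc (ℓ lam : ℝ) * Real.log lam
      ≤ C * (lam / (Real.log lam * Real.log lam ^ ε)) * Real.log lam := by gcongr
    _ = C / Real.log lam ^ ε * lam := by field_simp
    _ ≤ δ * lam := by
        refine mul_le_mul_of_nonneg_right ?_ (by positivity)
        rw [div_le_iff₀ hLε, mul_comm]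
        rwa [div_le_iff₀ hδ] at h3

theorem negligible_bound {ε : ℝ} (hε : 0 < ε) {ℓ t p : ℕ → ℕ}
    (hℓ : (fun lam : ℕ => (ℓ lam : ℝ)) =O[atTop]
      fun lam : ℕ => (lam : ℝ) / Real.log (lam : ℝ) ^ (1 + ε))
    (ht : PolyBounded t) (hp : PolyBounded p) :
    Negligible fun lam =>
      2 * ((p lam : ℝ) * ((p lam : ℝ) * ℓ lam + t lam) ^ (2 * ℓ lam) / 2 ^ lam) := by
  obtain ⟨a, ha⟩ := ht.eventually_le_pow
  obtain ⟨b, hb⟩ := hp.eventually_le_pow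
  -- With `ℓ ≤ lam`, one power pays for `ℓ` and one for the factor 2 from adding the two terms, so
  -- `p * ℓ + t ≤ lam ^ c` eventually. Below, `r` is `2 ^ (-1/2)`.
  set c := a + b + 2 with hc
  set r : ℝ := Real.exp (-(Real.log 2 / 2)) with hr
  have hlog2 : 0 < Real.log 2 := Real.log_pos (by norm_num)
  have hr1 : |r| < 1 := by
    rw [abs_of_pos (Real.exp_pos _), Real.exp_lt_one_iff]
    linarith
  have hlog : ∀ᶠ lam : ℕ in atTop, 1 ≤ Real.log (lam : ℝ) :=
    (Real.tendsto_log_atTop.comp tendsto_natCast_atTop_atTop).eventually_ge_atTop 1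
  have key : ∀ᶠ lam : ℕ in atTop,
      2 * ((p lam : ℝ) * ((p lam : ℝ) * ℓ lam + t lam) ^ (2 * ℓ lam) / 2 ^ lam) ≤
        2 * ((lam : ℝ) ^ b * r ^ lam) := by
    filter_upwards [ha, hb, hlog, eventually_ge_atTop 2, eventually_mul_log_le hε hℓ one_pos,
      -- This `δ` makes `2 * ℓ * c * log lam` at most `lam * log 2 / 2`, so the power consumes only
      -- half of the exponent of `2 ^ lam`.
      eventually_mul_log_le hε hℓ (δ := Real.log 2 / 2 / (2 * c)) (by positivity)]
      with lam h1 h2 h3 h4 h5 h6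
    have h4' : (0 : ℝ) < lam := by exact_mod_cast (by omega : 0 < lam)
    have hle : ℓ lam ≤ lam := by
      have : (ℓ lam : ℝ) ≤ lam := by
        have := mul_le_mul_of_nonneg_left h3 (Nat.cast_nonneg (α := ℝ) (ℓ lam))
        linarith
      exact_mod_cast this
    have hbase : p lam * ℓ lam + t lam ≤ lam ^ c := by
      have e1 : p lam * ℓ lam ≤ lam ^ (a + b + 1) := by
        refine (Nat.mul_le_mul h2 hle).trans ?_
        rw [← pow_succ]
        exact Nat.pow_le_pow_right (by omega) (by omega)
      have e2 : t lam ≤ lam ^ (a + b + 1) := h1.trans (Nat.pow_le_pow_right (by omega) (by omega))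
      calc p lam * ℓ lam + t lam ≤ 2 * lam ^ (a + b + 1) := by omega
        _ ≤ lam * lam ^ (a + b + 1) := Nat.mul_le_mul_right _ h4
        _ = lam ^ c := by rw [hc, ← pow_succ']
    have hpow : ((p lam : ℝ) * ℓ lam + t lam) ^ (2 * ℓ lam) ≤
        Real.exp (lam * (Real.log 2 / 2)) := by
      have e1 : ((p lam : ℝ) * ℓ lam + t lam) ≤ (lam : ℝ) ^ c := by exact_mod_cast hbase
      have e2 : (lam : ℝ) ^ c = Real.exp (c * Real.log lam) := by
        rw [Real.exp_nat_mul, Real.exp_log h4']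
      refine (pow_le_pow_left₀ (by positivity) e1 _).trans ?_
      rw [e2, ← Real.exp_nat_mul, Real.exp_le_exp]
      have hc0 : (0 : ℝ) < 2 * c := by positivity
      have := mul_le_mul_of_nonneg_left h6 hc0.le
      have e3 : 2 * (c : ℝ) * (Real.log 2 / 2 / (2 * c) * lam) = lam * (Real.log 2 / 2) := by
        have hc1 : (c : ℝ) ≠ 0 := by positivity
        field_simp
      rw [e3] at this
      push_cast
      linarith
    have h2pow : (2 : ℝ) ^ lam = Real.exp (lam * Real.log 2) := by
      rw [Real.exp_nat_mul, Real.exp_log (by norm_num)]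
    have hrl : r ^ lam = Real.exp (lam * (Real.log 2 / 2)) / 2 ^ lam := by
      rw [hr, ← Real.exp_nat_mul, h2pow, ← Real.exp_sub]
      congr 1
      ring
    have hp' : (p lam : ℝ) ≤ (lam : ℝ) ^ b := by exact_mod_cast h2
    rw [hrl, mul_div_assoc]
    gcongr
  intro z
  have hlim := (tendsto_pow_const_mul_const_pow_of_abs_lt_one (z + b) hr1).const_mul 2
  rw [mul_zero] at hlim
  refine squeeze_zero' (Eventually.of_forall fun lam => by positivity) ?_ hlim
  filter_upwards [key] with lam h
  calc (lam : ℝ) ^ z * (2 * ((p lam : ℝ) * ((p lam : ℝ) * ℓ lam + t lam) ^ (2 * ℓ lam) / 2 ^ lam))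
      ≤ (lam : ℝ) ^ z * (2 * ((lam : ℝ) ^ b * r ^ lam)) := by gcongr
    _ = 2 * ((lam : ℝ) ^ (z + b) * r ^ lam) := by rw [pow_add]; ring

end Asymptotic

/-! ### Assembly of security and the trace distance bounds. -/

theorem phaseMap_isMultiKeyPRSG {n ℓ : ℕ → ℕ} (hn : ∀ lam, lam ≤ n lam) {ε : ℝ} (hε : 0 < ε)
    (hℓ : Asymptotics.IsBigO Filter.atTop (fun lam : ℕ => (ℓ lam : ℝ))
      (fun lam : ℕ => (lam : ℝ) / Real.log (lam : ℝ) ^ (1 + ε))) :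
    IsMultiKeyPRSG n ℓ fun lam k => phaseMap (lam := lam) (n lam) k where
  qpt := phaseMap_isQPT hn
  channel _ k := phaseMap_isChannel _ k
  stateGeneration _ k ϑ := phaseMap_pure _ k ϑ
  pseudorandomness _ _ ht hp A :=
    ⟨_, negligible_bound hε hℓ ht hp, fun lam => (diffBound_multi (hn lam)).prob_le (A lam)⟩

end CHS

end

theorem mainTheorem3 :
    (∀ n : ℕ → ℕ, (∀ lam, lam ≤ n lam) →
      ∀ ε : ℝ, 0 < ε →
      ∀ ℓ : ℕ → ℕ,
        Asymptotics.IsBigO Filter.atTop (fun lam : ℕ => (ℓ lam : ℝ))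
          (fun lam : ℕ => (lam : ℝ) / Real.log (lam : ℝ) ^ (1 + ε)) →
        CHS.IsMultiKeyPRSG n ℓ (fun lam k => CHS.phaseMap (lam := lam) (n lam) k)) ∧
    (∃ c : ℝ, ∀ lam n ℓ t : ℕ, lam ≤ n →
      CHS.traceDist (CHS.realState (CHS.phaseMap (lam := lam) n) ℓ t)
          (CHS.idealState n ℓ t) ≤
        c * (((ℓ : ℝ) + t) ^ (2 * ℓ) / 2 ^ lam)) ∧
    (∃ c : ℝ, ∀ lam n ℓ t p : ℕ, lam ≤ n →
      CHS.traceDist (CHS.realStateMulti (CHS.phaseMap (lam := lam) n) ℓ t p)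
          (CHS.idealStateMulti n ℓ t p) ≤
        c * ((p : ℝ) * ((p : ℝ) * ℓ + t) ^ (2 * ℓ) / 2 ^ lam)) := by
  exact ⟨fun n hn ε hε ℓ hℓ => CHS.phaseMap_isMultiKeyPRSG hn hε hℓ,
    ⟨2, fun _ _ _ _ hn => (CHS.diffBound_single hn).traceDist_le⟩,
    ⟨2, fun _ _ _ _ _ hn => (CHS.diffBound_multi hn).traceDist_le⟩⟩
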